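/- Let $p$ be a prime and let $K$ be a finite extension of $\mathbb{Q}_p$, with its normalized absolute value $|x|=|N_{K/\mathbb{Q}_p}(x)|_p$ and its standard additive character $\psi=\psi_p\circ \mathrm{Tr}_{K/\mathbb{Q}_p}$, where $\psi_p(x)=e^{2\pi i\lambda(x)}$ and $\lambda(x)\in\mathbb{Z}[1/p]$ satisfies $\lambda(x)-x\in\mathbb{Z}_p$. Let $d^\times x$ be a Haar measure on $K^\times$ (of any normalization). A continuous function $f:K\to\mathbb{T}$ is a second degree character if $f(x+y)f(x)^{-1}f(y)^{-1}$ is a bicharacter; it is non-degenerate if the morphism $\varrho:K\to\widehat{K}$ defined by $f(x+y)f(x)^{-1}f(y)^{-1}=\langle \varrho(y),x\rangle$ is an isomorphism of topological groups. For $g:K^\times\to\mathbb{C}$ put $\mathcal{M}(g,s)=\int_{K^\times} g(x)|x|^s\,d^\times x$ (well defined when absolutely convergent) and $(\phi\star f)(y)=\int_{K^\times}\phi(x)f(x^{-1}y)\,d^\times x$. A number $M$ is the weak Mellin transform of $f$ at $|x|^s$ if for every locally constant, compactly supported $\phi:K^\times\to\mathbb{C}$ the convolution $\phi\star f$ is well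 defined (its integral converges absolutely at every $y$), $\mathcal{M}(\phi\star f,s)$ is well defined, and $\mathcal{M}(\phi\star f,s)=M\,\mathcal{M}(\phi,s)$. **Theorem.** Let $a,b\in K$ be such that $f(x)=\psi(\tfrac12ax^2+bx)$ is a non-degenerate second degree character on $K$. Then the weak Mellin transform $\zeta_f(s)$ of $f$ at $|x|^s$ exists for all $s$ with $\mathrm{Re}(s)>0$, is holomorphic there, and extends to a meromorphic function $\zeta_f$ on $\mathbb{C}$; and every zero of $\zeta_f$ in $\mathbb{C}$ lies on the line $\mathrm{Re}(s)=\tfrac12$. -/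

import Mathlib

open MeasureTheory

noncomputable section

namespace WeakMellin

/-! ### Second degree characters -/

section SecondDegree

variable {G : Type*} [AddCommGroup G] [TopologicalSpace G]

/-- The defect of additivity `f (x + y) f(x)⁻¹ f(y)⁻¹` of a circle-valued function. -/
def defect (f : G → Circle) (x y : G) : Circle :=
  f (x + y) * (f x)⁻¹ * (f y)⁻¹

/-- A (continuous) second degree character in the sense of Weil: a continuous function with values
in the circle whose additivity defect is a bicharacter. -/
structure IsSecondDegreeCharacter (f : G → Circle) : Prop where
  continuous : Continuous f
  add_left : ∀ x x' y, defect f (x + x') y = defect f x y * defect f x' y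
  add_right : ∀ x y y', defect f x (y + y') = defect f x y * defect f x y'

/-- A second degree character is non-degenerate if the morphism `ϱ` from `G` to its Pontryagin dual
with `f (x + y) f(x)⁻¹ f(y)⁻¹ = ⟨ϱ y, x⟩` is an isomorphism of topological groups.
(Mathlib's Pontryagin dual is multiplicative, hence the `Multiplicative G`.) -/
structure IsNondegenerateSecondDegreeCharacter (f : G → Circle) : Prop
    extends IsSecondDegreeCharacter f where
  exists_iso : ∃ ϱ : Multiplicative G ≃ₜ* PontryaginDual (Multiplicative G),
    ∀ x y : G, defect f x y = ϱ (Multiplicative.ofAdd y) (Multiplicative.ofAdd x)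

end SecondDegree

/-! ### The standard additive character of a `p`-adic local field -/

/-- Every `p`-adic number is congruent modulo `ℤ_p` to a rational number of the form `n / p ^ k`. -/
theorem exists_polarPart (p : ℕ) [hp : Fact p.Prime] (x : ℚ_[p]) :
    ∃ r : ℚ, (∃ (n : ℤ) (k : ℕ), r = n / (p : ℚ) ^ k) ∧ ‖(r : ℚ_[p]) - x‖ ≤ 1 := by
  have hp0 : (p : ℚ_[p]) ≠ 0 := by exact_mod_cast hp.out.ne_zero
  have hp1 : (1 : ℝ) < p := by exact_mod_cast hp.out.one_lt
  obtain ⟨k, hk⟩ := pow_unbounded_of_one_lt ‖x‖ hp1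
  have hy : ‖x * (p : ℚ_[p]) ^ k‖ ≤ 1 := by
    rw [norm_mul, norm_pow, Padic.norm_p, inv_pow, ← div_eq_mul_inv]
    exact (div_le_one (by positivity)).2 hk.le
  obtain ⟨y, hyx⟩ : ∃ y : ℤ_[p], (y : ℚ_[p]) = x * (p : ℚ_[p]) ^ k := ⟨⟨_, hy⟩, rfl⟩
  obtain ⟨c, hc⟩ := Ideal.mem_span_singleton'.1 (PadicInt.appr_spec k y)
  have hc' : (c : ℚ_[p]) * (p : ℚ_[p]) ^ k = x * (p : ℚ_[p]) ^ k - (y.appr k : ℚ_[p]) := by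
    rw [← hyx]
    exact_mod_cast congrArg (fun z : ℤ_[p] => (z : ℚ_[p])) hc
  refine ⟨((y.appr k : ℤ) : ℚ) / (p : ℚ) ^ k, ⟨_, k, rfl⟩, ?_⟩
  have : ((((y.appr k : ℤ) : ℚ) / (p : ℚ) ^ k : ℚ) : ℚ_[p]) - x = -(c : ℚ_[p]) := by
    push_cast
    field_simp
    linear_combination hc'
  rw [this, norm_neg]
  exact c.2

/-- A rational number `λ(x)` of the form `n / p ^ k` with `λ(x) - x ∈ ℤ_p`; it is unique up to the
addition of an integer. -/
def polarPart (p : ℕ) [Fact p.Prime] (x : ℚ_[p]) : ℚ :=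
  (exists_polarPart p x).choose

/-- The standard additive character `ψ_p(x) = exp (2πi λ(x))` of `ℚ_p`. -/
def stdCharPadic (p : ℕ) [Fact p.Prime] (x : ℚ_[p]) : Circle :=
  Circle.exp (2 * Real.pi * (polarPart p x : ℝ))

section LocalField

variable (p : ℕ) [Fact p.Prime] (K : Type*) [NormedField K] [NormedAlgebra ℚ_[p] K]

/-- The standard additive character `ψ = ψ_p ∘ Tr_{K/ℚ_p}` of a finite extension `K` of `ℚ_p`. -/
def stdChar (x : K) : Circle :=
  stdCharPadic p (Algebra.trace ℚ_[p] K x)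

/-- The function `f(x) = ψ(½ a x² + b x)`. -/
def quadChar (a b : K) (x : K) : Circle :=
  stdChar p K (1 / 2 * a * x ^ 2 + b * x)

/-- The normalized absolute value `|x|` of `K`. As the norm of `K` extends the one of `ℚ_p`, this is
`|N_{K/ℚ_p}(x)|_p`, and `|ϖ|⁻¹` is the cardinality of the residue field for a uniformizer `ϖ`. -/
def normAbs (x : K) : ℝ :=
  ‖x‖ ^ Module.finrank ℚ_[p] K

end LocalField

/-! ### Mellin transforms and weak Mellin transforms at `|x|^s` -/

section Mellin

variable (p : ℕ) [Fact p.Prime] {K : Type*} [NormedField K] [NormedAlgebra ℚ_[p] K]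

/-- The integrand `g(x) |x|^s` of the Mellin transform. -/
def mellinIntegrand (g : Kˣ → ℂ) (s : ℂ) (x : Kˣ) : ℂ :=
  g x * (normAbs p K (x : K) : ℂ) ^ s

variable [MeasurableSpace K]

/-- The Mellin transform of `g` at the unramified character `|x|^s`; it is well defined if
`mellinIntegrand p g s` is integrable. -/
def mellinTransform (μ : Measure Kˣ) (g : Kˣ → ℂ) (s : ℂ) : ℂ :=
  ∫ x, mellinIntegrand p g s x ∂μ

/-- The multiplicative convolution `(φ ⋆ f)(y) = ∫ φ(x) f(x⁻¹ y) d^×x`. -/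
def mulConv (μ : Measure Kˣ) (φ f : Kˣ → ℂ) (y : Kˣ) : ℂ :=
  ∫ x, φ x * f (x⁻¹ * y) ∂μ

/-- `M` is the value at `|x|^s` of the weak Mellin transform of `f`: for each test function `φ`
(locally constant with compact support on `Kˣ`), the convolution `φ ⋆ f` is well defined, its
Mellin transform converges absolutely at `s`, and it is `M` times the Mellin transform of `φ`. -/
def IsWeakMellinTransformAt (μ : Measure Kˣ) (f : Kˣ → ℂ) (s M : ℂ) : Prop :=
  ∀ φ : Kˣ → ℂ, IsLocallyConstant φ → HasCompactSupport φ →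
    (∀ y, Integrable (fun x => φ x * f (x⁻¹ * y)) μ) ∧
    Integrable (mellinIntegrand p (mulConv μ φ f) s) μ ∧
    mellinTransform p μ (mulConv μ φ f) s = M * mellinTransform p μ φ s

/-- `ζ` is the function `ζ_f`: its values for `Re s > 0` are those of the weak Mellin transform
of `f` at `|x|^s`, it is holomorphic there, and it is continued meromorphically to `ℂ`.
(By uniqueness of the continuation, `ζ` is determined by `f` up to its values at a discrete set of
points with `Re s ≤ 0`.) -/
structure IsLocalZeta (μ : Measure Kˣ) (f : Kˣ → ℂ) (ζ : ℂ → ℂ) : Prop where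
  isWeakMellin : ∀ s : ℂ, 0 < s.re → IsWeakMellinTransformAt p μ f s (ζ s)
  analyticAt : ∀ s : ℂ, 0 < s.re → AnalyticAt ℂ ζ s
  meromorphic : Meromorphic ζ

end Mellin

end WeakMellin

end

/-!
Let `O` be the ring of integers of `K`, `ϖ` a uniformizer, `r = |ϖ|` and `X = r ^ s`. Summing over
the spheres `ϖ ^ k Oˣ`, the weak Mellin transform of `f` is `∑ c k X ^ k`, where `c k` is the
integral of `f` over the `k`-th sphere; the sum is finite to the left, because `f` oscillates far
away, and geometric to the right, because `f = 1` near `0`. So it is `P(X) / (1 - X)` for a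
Laurent polynomial `P`, and the point is to show that the zeros of `P` satisfy `|X| = √r`.

Write `f (x + y) = f x * f y * β (x * y)` with `β` an additive character trivial on `ϖ ^ d O` and
not on `ϖ ^ (d - 1) O`. The lattice `L = ϖ ^ j O`, `j = ⌈d / 2⌉`, is contained in its orthogonal
`M = ϖ ^ (d - j) O` with `d - j ∈ {j - 1, j}`, and `f` restricted to `L` is a character. Averaging
over translations by `L` shows that outside `L` the integrals of `f` only see a coset `y₀ + M`
(`IsQuadratic.setIntegral_eq_inter`), over which the integral of `f` is a Gauss integral of known
absolute value (`IsQuadratic.norm_sq_setIntegral_spectralSet`). Inside `L` the integrals are those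
of a character. There are three cases (`IsQuadratic.exists_shell_integrals`).

* If `f` is trivial on `L` and `M = L`, then `P` is a monomial.

* If `f` is trivial on `L` and `M ≠ L`, then up to a monomial `P` is linear, with coefficients
  controlled by a normalized Gauss sum `τ` with `|τ| ^ 2 = 1 / r` (`norm_sq_eq_of_gauss`).

* Otherwise, up to a monomial, `P = (1 - X) * c + v * X ^ e * (X - r)` with `|c| ^ 2 = v ^ 2 * r ^
  (e + 1)`, and comparing absolute values shows that both terms balance only on `|X| = √r`
  (`norm_sq_eq_of_two_terms`). The argument is insensitive to the residue characteristic, as no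
  square is completed.

The passage to the multiplicative group uses that the modulus of `K` is the normalized absolute
value (`distribHaarChar_eq`), so that a Haar measure on `Kˣ` is a multiple of `dx / |x|`
(`exists_setIntegral_units_eq`), and that convolution with a test function only sees a bounded
part of `f` (`IsQuadratic.exists_mulConv_eq`), for which the Mellin transform converges
absolutely. A function which has the defining properties of the zeta function agrees with the
explicit one on the half-plane `0 < re s`, hence has the same zeros everywhere
(`meromorphicOrderAt_eq_of_eqOn_re_pos`).
-/

namespace WeakMellin

open Metric NNReal ENNReal Pointwise

/-! ### Uniformizers and the filtration by closed balls -/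

/-- `ϖ` is a uniformizer: it has the largest norm among the elements of norm less than `1`. -/
structure IsUniformizer {K : Type*} [NormedField K] (ϖ : K) : Prop where
  ne_zero : ϖ ≠ 0
  norm_lt_one : ‖ϖ‖ < 1
  norm_le : ∀ x : K, ‖x‖ < 1 → ‖x‖ ≤ ‖ϖ‖

theorem exists_isUniformizer {K : Type*} [NormedField K] [IsUltrametricDist K] [ProperSpace K]
    (h : ∃ x : K, x ≠ 0 ∧ ‖x‖ < 1) : ∃ ϖ : K, IsUniformizer ϖ := by
  obtain ⟨x, hx0, hx1⟩ := h
  have hc : IsCompact (ball (0 : K) 1) :=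
    (isCompact_closedBall (0 : K) 1).of_isClosed_subset (IsUltrametricDist.isClosed_ball _ _)
      ball_subset_closedBall
  obtain ⟨y, hy, hmax⟩ := hc.exists_isMaxOn ⟨x, by simpa using hx1⟩ continuous_norm.continuousOn
  refine ⟨y, ?_, by simpa using hy, fun z hz => hmax (by simpa using hz)⟩
  rintro rfl
  have := hmax (show x ∈ ball (0 : K) 1 by simpa using hx1)
  simp [hx0] at this

namespace IsUniformizer

variable {K : Type*} [NormedField K] {ϖ : K}

theorem norm_pos (h : IsUniformizer ϖ) : 0 < ‖ϖ‖ := norm_pos_iff.2 h.ne_zero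

theorem zpow_le_zpow_iff (h : IsUniformizer ϖ) {k l : ℤ} : ‖ϖ‖ ^ k ≤ ‖ϖ‖ ^ l ↔ l ≤ k :=
  zpow_le_zpow_iff_right_of_lt_one₀ h.norm_pos h.norm_lt_one

theorem zpow_lt_zpow_iff (h : IsUniformizer ϖ) {k l : ℤ} : ‖ϖ‖ ^ k < ‖ϖ‖ ^ l ↔ l < k :=
  zpow_lt_zpow_iff_right_of_lt_one₀ h.norm_pos h.norm_lt_one

/-- Every nonzero norm is a power of the norm of the uniformizer. -/
theorem exists_norm_eq (h : IsUniformizer ϖ) {x : K} (hx : x ≠ 0) : ∃ k : ℤ, ‖x‖ = ‖ϖ‖ ^ k := by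
  obtain ⟨k, hk1, hk2⟩ := exists_mem_Ioc_zpow (norm_pos_iff.2 hx)
    ((one_lt_inv₀ h.norm_pos).2 h.norm_lt_one)
  have hp := h.norm_pos
  rw [inv_zpow'] at hk1 hk2
  refine ⟨-(k + 1), le_antisymm hk2 ?_⟩
  by_contra! hlt
  have : ‖x * ϖ ^ (k + 1)‖ < 1 := by
    rw [norm_mul, norm_zpow]
    rw [zpow_neg] at hlt
    exact (lt_inv_mul_iff₀' (by positivity)).1 (by simpa using hlt)
  have := h.norm_le _ this
  rw [norm_mul, norm_zpow, zpow_add_one₀ hp.ne', ← mul_assoc] at this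
  have h2 : ‖x‖ * ‖ϖ‖ ^ k ≤ 1 := by
    by_contra! h3
    nlinarith
  rw [zpow_neg] at hk1
  have : ‖ϖ‖ ^ k * (‖ϖ‖ ^ k)⁻¹ = 1 := mul_inv_cancel₀ (by positivity)
  have h4 : 0 < ‖ϖ‖ ^ k := by positivity
  nlinarith

end IsUniformizer

section Ball

variable {K : Type*} [NormedField K] [IsUltrametricDist K]

/-- The lattice `ϖ ^ k O = {x | ‖x‖ ≤ ‖ϖ‖ ^ k}`. -/
def lattice (ϖ : K) (k : ℤ) : AddSubgroup K where
  carrier := {x | ‖x‖ ≤ ‖ϖ‖ ^ k}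
  zero_mem' := by
    simp only [Set.mem_ofPred_eq, norm_zero]
    positivity
  add_mem' := fun {a b} ha hb => (IsUltrametricDist.norm_add_le_max a b).trans (max_le ha hb)
  neg_mem' := fun {a} ha => by simpa using ha

/-- The sphere `{x | ‖x‖ = ‖ϖ‖ ^ k}`. -/
def shell (ϖ : K) (k : ℤ) : Set K := {x | ‖x‖ = ‖ϖ‖ ^ k}

variable {ϖ : K}

theorem mem_lattice {k : ℤ} {x : K} : x ∈ lattice ϖ k ↔ ‖x‖ ≤ ‖ϖ‖ ^ k := Iff.rfl

omit [IsUltrametricDist K] in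
theorem mem_shell {k : ℤ} {x : K} : x ∈ shell ϖ k ↔ ‖x‖ = ‖ϖ‖ ^ k := Iff.rfl

theorem coe_lattice (k : ℤ) : (lattice ϖ k : Set K) = closedBall 0 (‖ϖ‖ ^ k) := by
  ext x; simp [mem_lattice]

theorem isCompact_lattice [ProperSpace K] (k : ℤ) : IsCompact (lattice ϖ k : Set K) := by
  rw [coe_lattice]; exact isCompact_closedBall _ _

theorem isClosed_lattice (k : ℤ) : IsClosed (lattice ϖ k : Set K) := by
  rw [coe_lattice]; exact isClosed_closedBall

theorem IsUniformizer.isOpen_lattice (h : IsUniformizer ϖ) (k : ℤ) :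
    IsOpen (lattice ϖ k : Set K) := by
  have := h.norm_pos
  rw [coe_lattice]; exact IsUltrametricDist.isOpen_closedBall _ (by positivity)

theorem IsUniformizer.lattice_le_lattice (h : IsUniformizer ϖ) {k l : ℤ} (hkl : l ≤ k) :
    lattice ϖ k ≤ lattice ϖ l :=
  fun _ hx => le_trans hx (h.zpow_le_zpow_iff.2 hkl)

theorem IsUniformizer.mem_lattice_mul (h : IsUniformizer ϖ) {k l : ℤ} {x y : K}
    (hx : x ∈ lattice ϖ k) (hy : y ∈ lattice ϖ l) : x * y ∈ lattice ϖ (k + l) := by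
  rw [mem_lattice] at *
  rw [norm_mul, zpow_add₀ h.norm_pos.ne']
  exact mul_le_mul hx hy (_root_.norm_nonneg _) ((_root_.norm_nonneg _).trans hx)

omit [IsUltrametricDist K] in
theorem IsUniformizer.exists_mem_shell (h : IsUniformizer ϖ) {x : K} (hx : x ≠ 0) :
    ∃ k, x ∈ shell ϖ k := h.exists_norm_eq hx

theorem IsUniformizer.exists_mem_lattice (h : IsUniformizer ϖ) (x : K) :
    ∃ k, x ∈ lattice ϖ k := by
  rcases eq_or_ne x 0 with rfl | hx
  · exact ⟨0, zero_mem _⟩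
  · obtain ⟨k, hk⟩ := h.exists_mem_shell hx
    exact ⟨k, le_of_eq hk⟩

theorem IsUniformizer.shell_eq_diff (h : IsUniformizer ϖ) (k : ℤ) :
    shell ϖ k = (lattice ϖ k : Set K) \ lattice ϖ (k + 1) := by
  ext x
  simp only [mem_shell, Set.mem_sdiff, SetLike.mem_coe, mem_lattice, not_le]
  constructor
  · intro hx
    rw [hx, h.zpow_lt_zpow_iff]
    exact ⟨le_rfl, by lia⟩
  · rintro ⟨h1, h2⟩
    have hx : x ≠ 0 := by
      rintro rfl
      rw [norm_zero] at h2
      exact absurd h2 (not_lt.2 (by positivity))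
    obtain ⟨l, hl⟩ := h.exists_norm_eq hx
    rw [hl, h.zpow_le_zpow_iff] at h1
    rw [hl, h.zpow_lt_zpow_iff] at h2
    rw [hl, show l = k by lia]

theorem IsUniformizer.not_mem_lattice_of_mem_shell (h : IsUniformizer ϖ) {k l : ℤ} {x : K}
    (hx : x ∈ shell ϖ k) (hkl : k < l) : x ∉ lattice ϖ l := by
  rw [mem_lattice, mem_shell.1 hx, h.zpow_le_zpow_iff]
  lia

theorem IsUniformizer.eq_of_mem_shell (h : IsUniformizer ϖ) {k l : ℤ} {x : K}
    (hx : x ∈ shell ϖ k) (hx' : x ∈ shell ϖ l) : k = l := by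
  by_contra hne
  rcases lt_or_gt_of_ne hne with hlt | hlt
  · exact h.not_mem_lattice_of_mem_shell hx hlt (le_of_eq hx')
  · exact h.not_mem_lattice_of_mem_shell hx' hlt (le_of_eq hx)

theorem IsUniformizer.add_mem_shell (h : IsUniformizer ϖ) {k l : ℤ} {x y : K}
    (hx : x ∈ shell ϖ k) (hkl : k < l) (hy : y ∈ lattice ϖ l) : x + y ∈ shell ϖ k := by
  rw [h.shell_eq_diff] at hx ⊢
  exact ⟨add_mem hx.1 (h.lattice_le_lattice hkl.le hy), fun hxy =>
    hx.2 (by simpa using sub_mem hxy (h.lattice_le_lattice (by lia) hy))⟩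

/-- The lattices form a basis of neighbourhoods of `0`. -/
theorem IsUniformizer.exists_lattice_subset (h : IsUniformizer ϖ) {U : Set K}
    (hU : U ∈ nhds (0 : K)) : ∃ k : ℤ, (lattice ϖ k : Set K) ⊆ U := by
  obtain ⟨ε, hε, hεU⟩ := Metric.mem_nhds_iff.1 hU
  obtain ⟨n, hn⟩ := exists_pow_lt_of_lt_one hε h.norm_lt_one
  refine ⟨n, fun x hx => hεU ?_⟩
  rw [mem_ball_zero_iff]
  exact lt_of_le_of_lt (by simpa [mem_lattice] using hx) hn

end Ball

/-! ### The modulus of a `p`-adic local field -/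

section Modulus

theorem isUltrametricDist_of_padic (p : ℕ) [Fact p.Prime] (K : Type*) [NormedField K]
    [NormedAlgebra ℚ_[p] K] : IsUltrametricDist K := by
  apply IsUltrametricDist.isUltrametricDist_of_forall_norm_natCast_le_one
  intro n
  rw [← map_natCast (algebraMap ℚ_[p] K) n, norm_algebraMap']
  exact_mod_cast Padic.norm_int_le_one (p := p) n

theorem norm_natCast_prime (p : ℕ) [Fact p.Prime] (K : Type*) [NormedField K]
    [NormedAlgebra ℚ_[p] K] : ‖(p : K)‖ = (p : ℝ)⁻¹ := by
  rw [← map_natCast (algebraMap ℚ_[p] K) p, norm_algebraMap', Padic.norm_p]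

theorem existsUnique_fin_norm_sub_le (p : ℕ) [hp : Fact p.Prime] {x : ℚ_[p]} (hx : ‖x‖ ≤ 1) :
    ∃! c : Fin p, ‖x - ((c : ℕ) : ℚ_[p])‖ ≤ (p : ℝ)⁻¹ := by
  obtain ⟨X, rfl⟩ : ∃ X : ℤ_[p], (X : ℚ_[p]) = x := ⟨⟨x, hx⟩, rfl⟩
  have key : ∀ c : ℕ, X - c ∈ IsLocalRing.maximalIdeal ℤ_[p] ↔
      ‖(X : ℚ_[p]) - (c : ℚ_[p])‖ ≤ (p : ℝ)⁻¹ := by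
    intro c
    have h1 : ‖(X : ℚ_[p]) - (c : ℚ_[p])‖ = ‖X - c‖ := by
      rw [PadicInt.norm_def]; push_cast; rfl
    rw [h1, PadicInt.maximalIdeal_eq_span_p, Ideal.mem_span_singleton]
    constructor
    · rintro ⟨y, hy⟩
      rw [hy, norm_mul, PadicInt.norm_p]
      exact mul_le_of_le_one_right (by positivity) (PadicInt.norm_le_one y)
    · intro h
      rw [← PadicInt.norm_lt_one_iff_dvd]
      exact h.trans_lt (inv_lt_one_of_one_lt₀ (by exact_mod_cast hp.out.one_lt))
  obtain ⟨n, ⟨hn, hn'⟩, huniq⟩ := PadicInt.existsUnique_mem_range X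
  refine ⟨⟨n, hn⟩, (key n).1 hn', fun c hc => ?_⟩
  exact Fin.ext (huniq c ⟨c.2, (key c).2 hc⟩)

/-- The `ℤ_p`-lattice `Λ` spanned by a `ℚ_p`-basis is the union of `p ^ N` disjoint translates of
`pΛ`, which gives the modulus of `p`. -/
theorem distribHaarChar_prime (p : ℕ) [hp : Fact p.Prime] {K : Type*} [NormedField K]
    [NormedAlgebra ℚ_[p] K] [FiniteDimensional ℚ_[p] K] [MeasurableSpace K] [BorelSpace K]
    [LocallyCompactSpace K] [SecondCountableTopology K] (u : Kˣ) (hu : (u : K) = p) :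
    distribHaarChar K u = (p : ℝ≥0)⁻¹ ^ Module.finrank ℚ_[p] K := by
  classical
  let b := Module.finBasis ℚ_[p] K
  set N := Module.finrank ℚ_[p] K
  have hp0 : 0 < (p : ℝ) := by exact_mod_cast hp.out.pos
  let e : K ≃L[ℚ_[p]] (Fin N → ℚ_[p]) := b.equivFun.toContinuousLinearEquiv
  let Λ : Set K := e ⁻¹' closedBall 0 1
  have hΛ : ∀ x, x ∈ Λ ↔ ∀ i, ‖e x i‖ ≤ 1 := fun x => by
    simp [Λ, pi_norm_le_iff_of_nonneg]
  have hopen : IsOpen Λ :=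
    (IsUltrametricDist.isOpen_closedBall (0 : Fin N → ℚ_[p]) one_ne_zero).preimage e.continuous
  have hcpt : IsCompact Λ :=
    e.toHomeomorph.isCompact_preimage.2 (isCompact_closedBall (0 : Fin N → ℚ_[p]) 1)
  have huΛ : ∀ x, x ∈ u • Λ ↔ ∀ i, ‖e x i‖ ≤ (p : ℝ)⁻¹ := by
    intro x
    rw [Set.mem_smul_set_iff_inv_smul_mem, hΛ]
    refine forall_congr' fun i => ?_
    have : e (u⁻¹ • x) i = (p : ℚ_[p])⁻¹ * e x i := by
      have : u⁻¹ • x = (p : ℚ_[p])⁻¹ • x := by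
        rw [Units.smul_def, smul_eq_mul, Algebra.smul_def, Units.val_inv_eq_inv_val, hu, map_inv₀,
          map_natCast]
      rw [this, map_smul, Pi.smul_apply, smul_eq_mul]
    rw [this, norm_mul, norm_inv, Padic.norm_p, inv_inv, ← one_div, le_div_iff₀' hp0]
  let t : (Fin N → Fin p) → K := fun c => e.symm fun i => ((c i : ℕ) : ℚ_[p])
  have hmem : ∀ c x, x ∈ t c +ᵥ u • Λ ↔ ∀ i, ‖e x i - ((c i : ℕ) : ℚ_[p])‖ ≤ (p : ℝ)⁻¹ := by
    intro c x
    rw [Set.mem_vadd_set_iff_neg_vadd_mem, huΛ]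
    simp [t, vadd_eq_add, neg_add_eq_sub]
  have hunion : Λ = ⋃ c, t c +ᵥ u • Λ := by
    ext x
    simp only [Set.mem_iUnion, hmem, hΛ]
    constructor
    · intro h
      choose c hc using fun i => (existsUnique_fin_norm_sub_le p (h i)).exists
      exact ⟨c, hc⟩
    · rintro ⟨c, hc⟩ i
      have h1 : ‖((c i : ℕ) : ℚ_[p])‖ ≤ 1 := by
        exact_mod_cast Padic.norm_int_le_one (p := p) (c i : ℕ)
      have h2 := (hc i).trans (inv_le_one_of_one_le₀ (by exact_mod_cast hp.out.one_lt.le))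
      simpa using (IsUltrametricDist.norm_add_le_max (e x i - ((c i : ℕ) : ℚ_[p]))
        ((c i : ℕ) : ℚ_[p])).trans (max_le h2 h1)
  have hdisj : Pairwise (Function.onFun Disjoint fun c => t c +ᵥ u • Λ) := by
    intro c c' hne
    refine Set.disjoint_left.2 fun x hx hx' => hne (funext fun i => ?_)
    have hxΛ : x ∈ Λ := by rw [hunion]; exact Set.mem_iUnion.2 ⟨c, hx⟩
    exact (existsUnique_fin_norm_sub_le p ((hΛ x).1 hxΛ i)).unique ((hmem c x).1 hx i)
      ((hmem c' x).1 hx' i)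
  let ν : Measure K := Measure.addHaar
  have hsum : ν Λ = (p : ℝ≥0∞) ^ N * ν (u • Λ) := by
    conv_lhs => rw [hunion]
    rw [measure_iUnion hdisj fun c => ((hopen.smul u).vadd (t c)).measurableSet]
    simp [measure_vadd, tsum_fintype]
  refine distribHaarChar_eq_of_measure_smul_eq_mul (μ := ν) (s := Λ)
    (hopen.measure_pos ν ⟨0, by simp [hΛ]⟩).ne' hcpt.measure_ne_top ?_
  have hpN : ((p : ℝ≥0∞) ^ N) ≠ 0 := pow_ne_zero _ (by exact_mod_cast hp.out.ne_zero)
  have hpN' : ((p : ℝ≥0∞) ^ N) ≠ ∞ := ENNReal.pow_ne_top (ENNReal.natCast_ne_top p)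
  rw [hsum, ENNReal.coe_pow, ENNReal.coe_inv (by exact_mod_cast hp.out.ne_zero),
    ENNReal.coe_natCast, ← ENNReal.inv_pow, ← mul_assoc, ENNReal.inv_mul_cancel hpN hpN', one_mul]

/-- The modulus of `K` is the normalized absolute value. -/
theorem distribHaarChar_eq (p : ℕ) [hp : Fact p.Prime] {K : Type*} [NormedField K]
    [NormedAlgebra ℚ_[p] K] [FiniteDimensional ℚ_[p] K] [MeasurableSpace K] [BorelSpace K]
    [IsUltrametricDist K] [ProperSpace K] (u : Kˣ) :
    distribHaarChar K u = ‖(u : K)‖₊ ^ Module.finrank ℚ_[p] K := by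
  have hp1 : ‖(p : K)‖ < 1 := by
    rw [norm_natCast_prime p K]
    exact inv_lt_one_of_one_lt₀ (by exact_mod_cast hp.out.one_lt)
  have hp0 : (p : K) ≠ 0 := by
    rw [← norm_pos_iff, norm_natCast_prime p K, inv_pos]
    exact_mod_cast hp.out.pos
  obtain ⟨ϖ, hϖ⟩ := exists_isUniformizer ⟨(p : K), hp0, hp1⟩
  have hunit : ∀ v : Kˣ, ‖(v : K)‖ = 1 → distribHaarChar K v = 1 := by
    intro v hv
    let ν : Measure K := Measure.addHaar
    have hO := hϖ.isOpen_lattice 0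
    refine distribHaarChar_eq_of_measure_smul_eq_mul (μ := ν) (s := lattice ϖ 0)
      (hO.measure_pos ν ⟨0, zero_mem _⟩).ne' (isCompact_lattice 0).measure_ne_top ?_
    rw [ENNReal.coe_one, one_mul]
    congr 1
    ext x
    rw [Set.mem_smul_set_iff_inv_smul_mem, SetLike.mem_coe, SetLike.mem_coe, mem_lattice,
      mem_lattice, Units.smul_def, smul_eq_mul, norm_mul, Units.val_inv_eq_inv_val, norm_inv, hv,
      inv_one, one_mul]
  let w : Kˣ := Units.mk0 ϖ hϖ.ne_zero
  have hpow : ∀ (v : Kˣ) (k : ℤ), ‖(v : K)‖ = ‖ϖ‖ ^ k →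
      distribHaarChar K v = distribHaarChar K w ^ k := by
    intro v k hk
    have h1 : distribHaarChar K (v * (w ^ k)⁻¹) = 1 := by
      apply hunit
      have : ‖ϖ‖ ^ k ≠ 0 := (zpow_pos hϖ.norm_pos k).ne'
      simp [w, hk, this]
    rw [map_mul, map_inv, map_zpow] at h1
    exact eq_of_mul_inv_eq_one h1
  -- comparing the two sides at `p = ϖ ^ e · unit` yields the value at `ϖ`
  have hw : distribHaarChar K w = ‖ϖ‖₊ ^ Module.finrank ℚ_[p] K := by
    obtain ⟨e, he⟩ := hϖ.exists_norm_eq hp0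
    have h1 := hpow (Units.mk0 _ hp0) e he
    rw [distribHaarChar_prime p _ rfl] at h1
    have h2 : (p : ℝ≥0)⁻¹ = ‖ϖ‖₊ ^ e := by
      rw [← NNReal.coe_inj]
      push_cast
      rw [← he, norm_natCast_prime p K]
    rw [h2, ← zpow_natCast, zpow_comm] at h1
    have he0 : e ≠ 0 := by
      rintro rfl
      rw [he, zpow_zero] at hp1
      exact lt_irrefl _ hp1
    rw [← zpow_natCast]
    exact ((zpow_left_inj₀ (by positivity) (by positivity) he0).1 h1).symm
  obtain ⟨k, hk⟩ := hϖ.exists_norm_eq u.ne_zero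
  have hk' : ‖(u : K)‖₊ = ‖ϖ‖₊ ^ k := by
    rw [← NNReal.coe_inj]; push_cast; exact hk
  rw [hpow u k hk, hw, hk', ← zpow_natCast, ← zpow_natCast, zpow_comm]

end Modulus

/-! ### Quadratic characters and their additive integrals -/

section Quadratic

variable {K : Type*} [NormedField K] [IsUltrametricDist K] {ϖ : K}

/-- `f` is a circle-valued function, trivial near `0`, whose additivity defect is `β (x * y)` for an
additive character `β` that is trivial on `ϖ ^ d O` but not on `ϖ ^ (d - 1) O`. -/
structure IsQuadratic (ϖ : K) (d : ℤ) (β f : K → Circle) : Prop where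
  continuous : Continuous f
  map_add : ∀ x y, f (x + y) = f x * f y * β (x * y)
  char_add : ∀ x y, β (x + y) = β x * β y
  char_eq_one : ∀ x ∈ lattice ϖ d, β x = 1
  exists_char_ne_one : ∃ x ∈ lattice ϖ (d - 1), β x ≠ 1
  exists_eq_one : ∃ m, ∀ x ∈ lattice ϖ m, f x = 1

namespace IsQuadratic

variable {d : ℤ} {β f : K → Circle}

theorem continuous_char (h : IsQuadratic ϖ d β f) : Continuous β := by
  have : β = fun y => f (1 + y) * (f 1)⁻¹ * (f y)⁻¹ := by
    ext1 y
    rw [h.map_add 1 y, one_mul, mul_assoc, ← mul_inv, mul_inv_cancel_comm]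
  rw [this]
  have := h.continuous
  fun_prop

/-- The orthogonal of a lattice for the pairing `β (x * y)`. -/
theorem forall_mem_lattice_iff (h : IsQuadratic ϖ d β f) (hϖ : IsUniformizer ϖ) {k : ℤ} {y : K} :
    (∀ x ∈ lattice ϖ k, β (x * y) = 1) ↔ y ∈ lattice ϖ (d - k) := by
  constructor
  · intro hy
    by_contra hyk
    have hy0 : y ≠ 0 := by
      rintro rfl
      exact hyk (zero_mem _)
    obtain ⟨l, hl⟩ := hϖ.exists_mem_shell hy0
    have hlk : l < d - k := by
      by_contra! hlk
      exact hyk (hϖ.lattice_le_lattice hlk (le_of_eq hl))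
    obtain ⟨z, hz, hz1⟩ := h.exists_char_ne_one
    apply hz1
    have hyinv : y⁻¹ ∈ lattice ϖ (-l) := by
      rw [mem_lattice, norm_inv, mem_shell.1 hl, zpow_neg]
    have := hy (z * y⁻¹) (hϖ.lattice_le_lattice (by lia) (hϖ.mem_lattice_mul hz hyinv))
    rwa [inv_mul_cancel_right₀ hy0] at this
  · intro hy x hx
    apply h.char_eq_one
    have := hϖ.mem_lattice_mul hx hy
    rwa [add_sub_cancel] at this

/-- Translating the argument of `f` by `y` multiplies `f` by the constant `f y` and twists it by the
character `β (x * y)`. -/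
theorem twist (h : IsQuadratic ϖ d β f) (hϖ : IsUniformizer ϖ) (y : K) :
    IsQuadratic ϖ d β fun x => f x * β (x * y) where
  continuous := by
    have h1 := h.continuous
    have h2 := h.continuous_char
    fun_prop
  map_add x z := by
    rw [h.map_add, add_mul, h.char_add]
    simp only [mul_comm, mul_left_comm]
  char_add := h.char_add
  char_eq_one := h.char_eq_one
  exists_char_ne_one := h.exists_char_ne_one
  exists_eq_one := by
    obtain ⟨m, hm⟩ := h.exists_eq_one
    obtain ⟨k, hk⟩ := hϖ.exists_mem_lattice y
    refine ⟨max m (d - k), fun x hx => ?_⟩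
    rw [hm x (hϖ.lattice_le_lattice (le_max_left _ _) hx), one_mul]
    refine (h.forall_mem_lattice_iff hϖ).2 ?_ x
      (hϖ.lattice_le_lattice (le_max_right _ _) hx)
    rwa [_root_.sub_sub_cancel]

end IsQuadratic

variable [ProperSpace K] [MeasurableSpace K] [BorelSpace K] (ν : Measure K) [ν.IsAddHaarMeasure]

omit [IsUltrametricDist K] [ProperSpace K] in
theorem setIntegral_add_right (H : AddSubgroup K) (hH : MeasurableSet (H : Set K)) (g : K → ℂ)
    {y : K} (hy : y ∈ H) : ∫ x in (H : Set K), g (x + y) ∂ν = ∫ x in (H : Set K), g x ∂ν := by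
  rw [← integral_indicator hH, ← integral_indicator hH,
    ← integral_add_right_eq_self ((H : Set K).indicator g) y]
  congr 1 with x
  by_cases hx : x ∈ H
  · simp [hx, add_mem hx hy]
  · simp [hx, (H.add_mem_cancel_right hy).not.2 hx]

omit [IsUltrametricDist K] [ProperSpace K] in
/-- Orthogonality: a nontrivial character of a group has integral zero. -/
theorem setIntegral_char_eq_zero (H : AddSubgroup K) (hH : MeasurableSet (H : Set K))
    (χ : K → Circle) (hχ : ∀ x ∈ H, ∀ y ∈ H, χ (x + y) = χ x * χ y) (hne : ∃ y ∈ H, χ y ≠ 1) :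
    ∫ x in (H : Set K), (χ x : ℂ) ∂ν = 0 := by
  obtain ⟨y, hy, hy1⟩ := hne
  have h1 := setIntegral_add_right ν H hH (fun x => (χ x : ℂ)) hy
  rw [setIntegral_congr_fun hH fun x hx => by rw [hχ x hx y hy, Circle.coe_mul],
    integral_mul_const] at h1
  have h2 : (χ y : ℂ) ≠ 1 := fun h => hy1 (Circle.ext h)
  by_contra h0
  exact h2 (mul_left_cancel₀ h0 (by rw [h1, mul_one]))

omit [NormedField K] [IsUltrametricDist K] [ProperSpace K] [BorelSpace K]
  [ν.IsAddHaarMeasure] in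
theorem setIntegral_eq_measureReal {S : Set K} (hS : MeasurableSet S) {χ : K → Circle}
    (hχ : ∀ x ∈ S, χ x = 1) : ∫ x in S, (χ x : ℂ) ∂ν = ν.real S := by
  rw [setIntegral_congr_fun hS fun x hx => by rw [hχ x hx]]
  simp

omit [IsUltrametricDist K] [ν.IsAddHaarMeasure] in
theorem setIntegral_swap [SFinite ν] {S T : Set K} (hS : ν S ≠ ∞) (hT : ν T ≠ ∞) {G : K → K → ℂ}
    (hG : Continuous (Function.uncurry G)) (hb : ∀ x y, ‖G x y‖ ≤ 1) :
    ∫ x in S, ∫ y in T, G x y ∂ν ∂ν = ∫ y in T, ∫ x in S, G x y ∂ν ∂ν := by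
  have : IsFiniteMeasure (ν.restrict S) := ⟨by simpa using hS.lt_top⟩
  have : IsFiniteMeasure (ν.restrict T) := ⟨by simpa using hT.lt_top⟩
  exact integral_integral_swap (Integrable.of_bound hG.aestronglyMeasurable 1
    (Filter.Eventually.of_forall fun z => hb z.1 z.2))

namespace IsQuadratic

variable {d : ℤ} {β f : K → Circle}

omit [BorelSpace K] [ν.IsAddHaarMeasure] in
theorem measure_lattice_ne_top [IsFiniteMeasureOnCompacts ν] (k : ℤ) :
    ν (lattice ϖ k : Set K) ≠ ∞ :=
  (isCompact_lattice k).measure_ne_top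

omit [ProperSpace K] in
theorem measurableSet_lattice (k : ℤ) : MeasurableSet (lattice ϖ k : Set K) :=
  (isClosed_lattice k).measurableSet

/-- The absolute value of a Gauss integral over a lattice on whose orthogonal `f` is trivial. -/
theorem norm_sq_setIntegral (h : IsQuadratic ϖ d β f) (hϖ : IsUniformizer ϖ) {k : ℤ}
    (hk : k ≤ d - k) (h1 : ∀ x ∈ lattice ϖ (d - k), f x = 1) :
    ‖∫ x in (lattice ϖ k : Set K), (f x : ℂ) ∂ν‖ ^ 2 =
      ν.real (lattice ϖ k : Set K) * ν.real (lattice ϖ (d - k) : Set K) := by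
  have hf := h.continuous
  have hβ := h.continuous_char
  set S := lattice ϖ k
  have hS : MeasurableSet (S : Set K) := measurableSet_lattice k
  have hfin : ν (S : Set K) ≠ ∞ := measure_lattice_ne_top ν k
  have hinner : ∀ x, ∫ y in (S : Set K), (f x * β (x * y) : ℂ) ∂ν =
      (lattice ϖ (d - k) : Set K).indicator (fun _ => (ν.real (S : Set K) : ℂ)) x := by
    intro x
    rw [integral_const_mul]
    by_cases hx : x ∈ lattice ϖ (d - k)
    · rw [Set.indicator_of_mem hx, setIntegral_eq_measureReal (χ := fun y => β (x * y)) ν hS,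
        h1 x hx, Circle.coe_one, one_mul]
      intro y hy
      rw [mul_comm]
      exact (h.forall_mem_lattice_iff hϖ).2 hx y hy
    · rw [Set.indicator_of_notMem hx, setIntegral_char_eq_zero (χ := fun y => β (x * y)) ν S hS,
        mul_zero]
      · intro y _ z _
        rw [mul_add, h.char_add]
      · rw [← h.forall_mem_lattice_iff hϖ] at hx
        push Not at hx
        obtain ⟨y, hy, hxy⟩ := hx
        exact ⟨y, hy, by rwa [mul_comm]⟩
  have key : (∫ x in (S : Set K), (f x : ℂ) ∂ν) *
      (starRingEnd ℂ) (∫ x in (S : Set K), (f x : ℂ) ∂ν) =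
      ν.real (S : Set K) * ν.real (lattice ϖ (d - k) : Set K) := by
    calc _ = ∫ y in (S : Set K),
            (starRingEnd ℂ) (f y : ℂ) * ∫ x in (S : Set K), (f x : ℂ) ∂ν ∂ν := by
          rw [integral_mul_const, integral_conj, mul_comm]
      _ = ∫ y in (S : Set K), ∫ x in (S : Set K), (f x * β (x * y) : ℂ) ∂ν ∂ν := by
          refine setIntegral_congr_fun hS fun y hy => ?_
          rw [← setIntegral_add_right ν S hS (fun x => (f x : ℂ)) hy, ← integral_const_mul]
          congr 1 with x
          rw [h.map_add, ← Circle.coe_inv_eq_conj]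
          push_cast
          field_simp [(f y).coe_ne_zero]
      _ = ∫ x in (S : Set K), ∫ y in (S : Set K), (f x * β (x * y) : ℂ) ∂ν ∂ν := by
          refine setIntegral_swap ν (G := fun y x => (f x * β (x * y) : ℂ)) hfin hfin ?_
            fun y x => by rw [norm_mul, Circle.norm_coe, Circle.norm_coe, one_mul]
          simp only [Function.uncurry_def]
          fun_prop
      _ = _ := by
          simp_rw [hinner]
          rw [setIntegral_indicator (measurableSet_lattice _),
            Set.inter_eq_self_of_subset_right (hϖ.lattice_le_lattice hk)]
          simp [mul_comm]
  rw [Complex.mul_conj, Complex.normSq_eq_norm_sq] at key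
  exact_mod_cast key

/-- The set of all `y` for which `f` restricted to `ϖ ^ j O` is the character `x ↦ β (x * y)⁻¹`. -/
def spectralSet (ϖ : K) (β f : K → Circle) (j : ℤ) : Set K :=
  {y | ∀ x ∈ lattice ϖ j, f x * β (x * y) = 1}

omit [ProperSpace K] [MeasurableSpace K] [BorelSpace K] in
theorem isClosed_spectralSet (h : IsQuadratic ϖ d β f) (j : ℤ) :
    IsClosed (spectralSet ϖ β f j) := by
  have hβ := h.continuous_char
  simp only [spectralSet, Set.ofPred_forall]
  exact isClosed_iInter fun x => isClosed_iInter fun _ =>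
    isClosed_eq (by fun_prop) continuous_const

omit [ProperSpace K] [MeasurableSpace K] [BorelSpace K] in
theorem char_eq_one_of_mem (h : IsQuadratic ϖ d β f) (hϖ : IsUniformizer ϖ) {j : ℤ} (hj : d ≤ 2 * j)
    {x y : K} (hx : x ∈ lattice ϖ j) (hy : y ∈ lattice ϖ j) : β (x * y) = 1 :=
  h.char_eq_one _ (hϖ.lattice_le_lattice (by lia) (hϖ.mem_lattice_mul hx hy))

/-- Averaging over translations by a lattice on which `f` is a character shows that the integral
of `f` is concentrated on the spectral set. -/
theorem setIntegral_eq_inter (h : IsQuadratic ϖ d β f) (hϖ : IsUniformizer ϖ) {j : ℤ}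
    (hj : d ≤ 2 * j) {S : Set K} (hS : MeasurableSet S) (hfin : ν S ≠ ∞)
    (hinv : ∀ x ∈ lattice ϖ j, ∀ y, x + y ∈ S ↔ y ∈ S) :
    ∫ y in S, (f y : ℂ) ∂ν = ∫ y in S ∩ spectralSet ϖ β f j, (f y : ℂ) ∂ν := by
  have hf := h.continuous
  have hβ := h.continuous_char
  have hL : MeasurableSet (lattice ϖ j : Set K) := measurableSet_lattice j
  have hL0 : (ν.real (lattice ϖ j : Set K) : ℂ) ≠ 0 := by
    have := (hϖ.isOpen_lattice j).measure_pos ν ⟨0, zero_mem _⟩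
    exact_mod_cast (ENNReal.toReal_pos this.ne' (measure_lattice_ne_top ν j)).ne'
  have hinner : ∀ y, ∫ x in (lattice ϖ j : Set K), (f (x + y) : ℂ) ∂ν =
      (spectralSet ϖ β f j).indicator (fun y => ν.real (lattice ϖ j : Set K) * (f y : ℂ)) y := by
    intro y
    have h1 : ∀ x, (f (x + y) : ℂ) = ((f x * β (x * y) : Circle) : ℂ) * f y := fun x => by
      rw [h.map_add]; push_cast; ring
    simp_rw [h1]
    rw [integral_mul_const]
    by_cases hy : y ∈ spectralSet ϖ β f j
    · rw [Set.indicator_of_mem hy, setIntegral_eq_measureReal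
        (χ := fun x => f x * β (x * y)) ν hL fun x hx => hy x hx]
    · rw [Set.indicator_of_notMem hy, setIntegral_char_eq_zero
        (χ := fun x => f x * β (x * y)) ν _ hL, zero_mul]
      · intro x hx z hz
        rw [h.map_add, h.char_eq_one_of_mem hϖ hj hx hz, add_mul, h.char_add, mul_one,
          mul_mul_mul_comm]
      · simpa [spectralSet] using hy
  have htrans : ∀ x ∈ (lattice ϖ j : Set K),
      ∫ y in S, (f (x + y) : ℂ) ∂ν = ∫ y in S, (f y : ℂ) ∂ν := by
    intro x hx
    rw [← integral_indicator hS, ← integral_indicator hS,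
      ← integral_add_left_eq_self (S.indicator fun y => (f y : ℂ)) x]
    congr 1 with y
    by_cases hy : y ∈ S
    · rw [Set.indicator_of_mem hy, Set.indicator_of_mem ((hinv x hx y).2 hy)]
    · rw [Set.indicator_of_notMem hy, Set.indicator_of_notMem ((hinv x hx y).not.2 hy)]
  refine mul_left_cancel₀ hL0 ?_
  calc _ = ∫ x in (lattice ϖ j : Set K), ∫ y in S, (f (x + y) : ℂ) ∂ν ∂ν := by
        rw [setIntegral_congr_fun hL htrans]
        simp
    _ = ∫ y in S, ∫ x in (lattice ϖ j : Set K), (f (x + y) : ℂ) ∂ν ∂ν := by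
        refine setIntegral_swap ν (G := fun x y => (f (x + y) : ℂ)) (measure_lattice_ne_top ν j)
          hfin ?_ fun x y => by rw [Circle.norm_coe]
        simp only [Function.uncurry_def]
        fun_prop
    _ = _ := by
        simp_rw [hinner]
        rw [setIntegral_indicator (h.isClosed_spectralSet j).measurableSet, integral_const_mul]

/-- If the spectral set were empty, the integrals of `f` over large lattices would vanish. -/
theorem nonempty_spectralSet (h : IsQuadratic ϖ d β f) (hϖ : IsUniformizer ϖ) {j : ℤ}
    (hj : d ≤ 2 * j) (ν : Measure K) [ν.IsAddHaarMeasure] : (spectralSet ϖ β f j).Nonempty := by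
  by_contra hne
  rw [Set.not_nonempty_iff_eq_empty] at hne
  obtain ⟨m, hm⟩ := h.exists_eq_one
  have hpos : ∀ k, 0 < ν.real (lattice ϖ k : Set K) := fun k =>
    ENNReal.toReal_pos ((hϖ.isOpen_lattice k).measure_pos ν ⟨0, zero_mem _⟩).ne'
      (measure_lattice_ne_top ν k)
  -- `k` is chosen so that `ϖ ^ k O` contains both `ϖ ^ j O` and its own orthogonal
  set k := min j (min (d - m) (d - j))
  have h1 := h.norm_sq_setIntegral ν hϖ (k := k) (by lia)
    fun x hx => hm x (hϖ.lattice_le_lattice (by lia) hx)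
  rw [h.setIntegral_eq_inter ν hϖ hj (measurableSet_lattice k) (measure_lattice_ne_top ν k)
    (fun x hx y => AddSubgroup.add_mem_cancel_left _ (hϖ.lattice_le_lattice (by lia) hx)),
    hne] at h1
  simp only [Set.inter_empty, Measure.restrict_empty, integral_zero_measure, norm_zero] at h1
  have := mul_pos (hpos k) (hpos (d - k))
  rw [← h1] at this
  norm_num at this

omit [ProperSpace K] [MeasurableSpace K] [BorelSpace K] in
/-- The spectral set is a coset of the orthogonal of `ϖ ^ j O`. -/
theorem mem_spectralSet_iff (h : IsQuadratic ϖ d β f) (hϖ : IsUniformizer ϖ) {j : ℤ} {y₀ y : K}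
    (hy₀ : y₀ ∈ spectralSet ϖ β f j) :
    y ∈ spectralSet ϖ β f j ↔ y - y₀ ∈ lattice ϖ (d - j) := by
  rw [← h.forall_mem_lattice_iff hϖ]
  refine forall₂_congr fun x hx => ?_
  have h1 := hy₀ x hx
  have h2 : β (x * y) = β (x * y₀) * β (x * (y - y₀)) := by
    rw [← h.char_add]; ring_nf
  rw [h2, ← mul_assoc, h1, one_mul]

omit [ProperSpace K] [MeasurableSpace K] [BorelSpace K] in
theorem exists_spectralSet_subset (h : IsQuadratic ϖ d β f) (hϖ : IsUniformizer ϖ) (j : ℤ) :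
    ∃ k, spectralSet ϖ β f j ⊆ lattice ϖ k := by
  rcases (spectralSet ϖ β f j).eq_empty_or_nonempty with he | ⟨y₀, hy₀⟩
  · exact ⟨0, by simp [he]⟩
  · obtain ⟨k, hk⟩ := hϖ.exists_mem_lattice y₀
    refine ⟨min k (d - j), fun y hy => ?_⟩
    have := (h.mem_spectralSet_iff hϖ hy₀).1 hy
    have h1 := add_mem (hϖ.lattice_le_lattice (min_le_right k (d - j)) this)
      (hϖ.lattice_le_lattice (min_le_left k (d - j)) hk)
    rwa [sub_add_cancel] at h1

theorem norm_sq_setIntegral_spectralSet (h : IsQuadratic ϖ d β f) (hϖ : IsUniformizer ϖ) {j : ℤ}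
    (hj : d ≤ 2 * j) :
    ‖∫ x in spectralSet ϖ β f j, (f x : ℂ) ∂ν‖ ^ 2 =
      ν.real (lattice ϖ (d - j) : Set K) * ν.real (lattice ϖ j : Set K) := by
  obtain ⟨y₀, hy₀⟩ := h.nonempty_spectralSet hϖ hj ν
  have hM : MeasurableSet (lattice ϖ (d - j) : Set K) := measurableSet_lattice _
  have h1 : ∫ x in spectralSet ϖ β f j, (f x : ℂ) ∂ν =
      (∫ x in (lattice ϖ (d - j) : Set K), ((f x * β (x * y₀) : Circle) : ℂ) ∂ν) * f y₀ := by
    rw [← integral_mul_const, ← integral_indicator hM,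
      ← integral_indicator (h.isClosed_spectralSet j).measurableSet,
      ← integral_add_right_eq_self _ y₀]
    congr 1 with x
    by_cases hx : x ∈ lattice ϖ (d - j)
    · rw [Set.indicator_of_mem hx, Set.indicator_of_mem
        ((h.mem_spectralSet_iff hϖ hy₀).2 (by rwa [add_sub_cancel_right])), h.map_add]
      push_cast
      ring
    · rw [Set.indicator_of_notMem hx, Set.indicator_of_notMem
        ((h.mem_spectralSet_iff hϖ hy₀).not.2 (by rwa [add_sub_cancel_right]))]
  rw [h1, norm_mul, Circle.norm_coe, mul_one, (h.twist hϖ y₀).norm_sq_setIntegral ν hϖ (by lia),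
    _root_.sub_sub_cancel]
  rw [_root_.sub_sub_cancel]
  exact hy₀

end IsQuadratic

end Quadratic

/-! ### Location of the zeros of two rational functions -/

section Zeros

theorem norm_sub_sq_real (z : ℂ) (t : ℝ) : ‖z - t‖ ^ 2 = ‖z‖ ^ 2 - 2 * t * z.re + t ^ 2 := by
  rw [← Complex.normSq_eq_norm_sq, ← Complex.normSq_eq_norm_sq, Complex.normSq_apply,
    Complex.normSq_apply]
  simp
  ring

/-- As `|r * τ - 1| ^ 2 * r = |r * (τ - 1)| ^ 2`, the two sides of `r * (τ - 1) = X * (r * τ - 1)`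
have the ratio of absolute values `|X| / √r`. -/
theorem norm_sq_eq_of_gauss {r : ℝ} (hr0 : 0 < r) (hr1 : r < 1) {τ X : ℂ}
    (hτ : r * ‖τ‖ ^ 2 = 1)
    (h : r * (1 - X) * (τ - 1) + (1 - r) * X = 0) : ‖X‖ ^ 2 = r := by
  have h1 : (r : ℂ) * (τ - (1 : ℝ)) = X * (r * τ - (1 : ℝ)) := by
    push_cast
    linear_combination h
  have h2 : r ^ 2 * ‖τ - (1 : ℝ)‖ ^ 2 = ‖X‖ ^ 2 * ‖r * τ - (1 : ℝ)‖ ^ 2 := by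
    have h2 := congrArg (fun z => ‖z‖ ^ 2) h1
    simpa only [norm_mul, mul_pow, Complex.norm_real, Real.norm_eq_abs, sq_abs] using h2
  have h3 : ‖r * τ - (1 : ℝ)‖ ^ 2 = r - 2 * r * τ.re + 1 := by
    rw [norm_sub_sq_real, norm_mul, Complex.norm_real, Real.norm_eq_abs, mul_pow, sq_abs,
      Complex.re_ofReal_mul]
    linear_combination r * hτ
  have h4 : r ^ 2 * ‖τ - (1 : ℝ)‖ ^ 2 = r * ‖r * τ - (1 : ℝ)‖ ^ 2 := by
    rw [h3, norm_sub_sq_real]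
    linear_combination r * hτ
  rw [h4] at h2
  have h5 : ‖r * τ - (1 : ℝ)‖ ^ 2 ≠ 0 := by
    intro h0
    have h6 : (r : ℂ) * τ = (1 : ℝ) := by
      rw [← sub_eq_zero, ← norm_eq_zero]
      exact pow_eq_zero_iff two_ne_zero |>.1 h0
    have h7 : r * ‖τ‖ = 1 := by
      have := congrArg norm h6
      rwa [norm_mul, Complex.norm_real, Complex.norm_real, Real.norm_of_nonneg hr0.le,
        norm_one] at this
    nlinarith
  exact (mul_right_cancel₀ h5 h2).symm

/-- As `|X - r| < √r * |1 - X|` exactly for `|X| < √r`, the two terms have different absolute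
values off the circle `|X| = √r`. -/
theorem norm_sq_eq_of_two_terms {r v : ℝ} (hr0 : 0 < r) (hr1 : r < 1) (hv : 0 < v) {e : ℕ}
    {c X : ℂ} (hc : ‖c‖ ^ 2 = v ^ 2 * r ^ (e + 1))
    (h : (1 - X) * c + v * X ^ e * (X - r) = 0) : ‖X‖ ^ 2 = r := by
  have h1 : (X - (1 : ℝ)) * c = v * X ^ e * (X - (r : ℝ)) := by
    push_cast
    linear_combination -h
  have h2 : ‖X - (1 : ℝ)‖ ^ 2 * r ^ (e + 1) = (‖X‖ ^ 2) ^ e * ‖X - (r : ℝ)‖ ^ 2 := by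
    have h3 := congrArg (fun z => ‖z‖ ^ 2) h1
    simp only [norm_mul, mul_pow, hc, norm_pow, Complex.norm_real, Real.norm_eq_abs, sq_abs] at h3
    have : v ^ 2 ≠ 0 := by positivity
    refine mul_left_cancel₀ this ?_
    rw [← pow_mul, mul_comm 2 e, pow_mul]
    linear_combination h3
  have hA := norm_sub_sq_real X 1
  have hB := norm_sub_sq_real X r
  set t := ‖X‖ ^ 2
  have ht : 0 ≤ t := by positivity
  have hre' : 0 < r ^ e := by positivity
  have hA0 : 0 ≤ ‖X - (r : ℝ)‖ ^ 2 := by positivity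
  have hdiff : ‖X - (r : ℝ)‖ ^ 2 - r * ‖X - (1 : ℝ)‖ ^ 2 = (t - r) * (1 - r) := by
    rw [hA, hB]; ring
  rw [pow_succ r e] at h2
  rcases lt_trichotomy t r with hlt | heq | hgt
  · exfalso
    have h4 : t ^ e ≤ r ^ e := pow_le_pow_left₀ ht hlt.le e
    have h5 : ‖X - (r : ℝ)‖ ^ 2 < r * ‖X - (1 : ℝ)‖ ^ 2 := by nlinarith
    nlinarith [mul_le_mul_of_nonneg_right h4 hA0, mul_lt_mul_of_pos_left h5 hre']
  · exact heq
  · exfalso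
    have h4 : r ^ e ≤ t ^ e := pow_le_pow_left₀ hr0.le hgt.le e
    have h5 : r * ‖X - (1 : ℝ)‖ ^ 2 < ‖X - (r : ℝ)‖ ^ 2 := by nlinarith
    nlinarith [mul_le_mul_of_nonneg_right h4 hA0, mul_lt_mul_of_pos_left h5 hre']

end Zeros

/-! ### Integrals of a quadratic character over spheres -/

namespace IsQuadratic

variable {K : Type*} [NormedField K] [IsUltrametricDist K] {ϖ : K} {d : ℤ} {β f : K → Circle}

variable [ProperSpace K] [MeasurableSpace K] [BorelSpace K] (ν : Measure K) [ν.IsAddHaarMeasure]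

omit [ProperSpace K] in
theorem setIntegral_lattice_eq_zero (h : IsQuadratic ϖ d β f) (hϖ : IsUniformizer ϖ) {j k : ℤ}
    (hj : d ≤ 2 * j) (hjk : j ≤ k) (hk : ∃ x ∈ lattice ϖ k, f x ≠ 1) :
    ∫ x in (lattice ϖ k : Set K), (f x : ℂ) ∂ν = 0 := by
  refine setIntegral_char_eq_zero ν _ (measurableSet_lattice k) f (fun x hx y hy => ?_) hk
  rw [h.map_add, h.char_eq_one_of_mem hϖ hj (hϖ.lattice_le_lattice hjk hx)
    (hϖ.lattice_le_lattice hjk hy), mul_one]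

theorem setIntegral_shell (hf : Continuous f) (hϖ : IsUniformizer ϖ) (k : ℤ) :
    ∫ x in shell ϖ k, (f x : ℂ) ∂ν = ∫ x in (lattice ϖ k : Set K), (f x : ℂ) ∂ν -
      ∫ x in (lattice ϖ (k + 1) : Set K), (f x : ℂ) ∂ν := by
  rw [hϖ.shell_eq_diff, setIntegral_sdiff (measurableSet_lattice _) _
    (hϖ.lattice_le_lattice (by lia))]
  exact ContinuousOn.integrableOn_compact (isCompact_lattice k) (by fun_prop)

theorem setIntegral_shell_eq_inter (h : IsQuadratic ϖ d β f) (hϖ : IsUniformizer ϖ) {j k : ℤ}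
    (hj : d ≤ 2 * j) (hkj : k < j) :
    ∫ x in shell ϖ k, (f x : ℂ) ∂ν =
      ∫ x in shell ϖ k ∩ spectralSet ϖ β f j, (f x : ℂ) ∂ν := by
  refine h.setIntegral_eq_inter ν hϖ hj ?_ ?_ fun x hx y => ?_
  · rw [hϖ.shell_eq_diff]
    exact (measurableSet_lattice _).diff (measurableSet_lattice _)
  · rw [hϖ.shell_eq_diff]
    exact measure_ne_top_of_subset Set.sdiff_subset (measure_lattice_ne_top ν k)
  · constructor
    · intro hxy
      simpa using hϖ.add_mem_shell hxy hkj (neg_mem hx)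
    · intro hy
      rw [add_comm]
      exact hϖ.add_mem_shell hy hkj hx

/-- The generating function of the integrals of `f` over the spheres, weighted by the inverse of the
modulus, is `P(X) / (1 - X)` for a Laurent polynomial `P` with all zeros on `|X| = √r`. -/
theorem exists_shell_integrals (h : IsQuadratic ϖ d β f) (hϖ : IsUniformizer ϖ) {r v : ℝ}
    (hr0 : 0 < r) (hr1 : r < 1) (hv : 0 < v)
    (hν : ∀ k, ν.real (lattice ϖ k : Set K) = r ^ k * v) :
    ∃ l n : ℤ, l ≤ n ∧ (∀ k < l, ∫ x in shell ϖ k, (f x : ℂ) ∂ν = 0) ∧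
      (∀ k, n ≤ k → (r : ℂ) ^ (-k) * ∫ x in shell ϖ k, (f x : ℂ) ∂ν = v * (1 - r)) ∧
      ∀ X : ℂ, X ≠ 0 →
        (1 - X) * ∑ k ∈ Finset.Ico l n, ((r : ℂ) ^ (-k) * ∫ x in shell ϖ k, (f x : ℂ) ∂ν) * X ^ k
          + v * (1 - r) * X ^ n = 0 → ‖X‖ ^ 2 = r := by
  have hrC : (r : ℂ) ≠ 0 := by exact_mod_cast hr0.ne'
  have hvC : (v : ℂ) ≠ 0 := by exact_mod_cast hv.ne'
  have h1r : (1 - r : ℂ) ≠ 0 := by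
    have : (1 - r : ℝ) ≠ 0 := by linarith
    exact_mod_cast this
  -- `ϖ ^ j O` is contained in its orthogonal, which is contained in `ϖ ^ (j - 1) O`
  set j : ℤ := (d + 1) / 2
  have hj : d ≤ 2 * j := by lia
  have hj' : 2 * j ≤ d + 1 := by lia
  obtain ⟨m, hm⟩ := h.exists_eq_one
  obtain ⟨n, ⟨hjn, hn⟩, hmin⟩ := Int.exists_least_of_bdd
    (P := fun n => j ≤ n ∧ ∀ x ∈ lattice ϖ n, f x = 1) ⟨j, fun z hz => hz.1⟩
    ⟨max j m, le_max_left _ _, fun x hx => hm x (hϖ.lattice_le_lattice (le_max_right _ _) hx)⟩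
  have hlat : ∀ k, n ≤ k → ∫ x in (lattice ϖ k : Set K), (f x : ℂ) ∂ν = r ^ k * v := by
    intro k hk
    rw [setIntegral_eq_measureReal ν (measurableSet_lattice k)
      fun x hx => hn x (hϖ.lattice_le_lattice hk hx), hν]
    push_cast
    rfl
  have hlat0 : ∀ k, j ≤ k → k < n → ∫ x in (lattice ϖ k : Set K), (f x : ℂ) ∂ν = 0 := by
    intro k hk hkn
    refine h.setIntegral_lattice_eq_zero ν hϖ hj hk ?_
    by_contra! hne
    have := hmin k ⟨hk, hne⟩
    lia
  have hbig : ∀ k, n ≤ k →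
      (r : ℂ) ^ (-k) * ∫ x in shell ϖ k, (f x : ℂ) ∂ν = v * (1 - r) := by
    intro k hk
    rw [setIntegral_shell ν h.continuous hϖ, hlat k hk, hlat (k + 1) (by lia), zpow_add_one₀ hrC,
      zpow_neg]
    have : (r : ℂ) ^ k ≠ 0 := zpow_ne_zero _ hrC
    field_simp
  have hgauss := h.norm_sq_setIntegral_spectralSet ν hϖ hj
  rcases eq_or_lt_of_le hjn with hjn | hjn
  · -- `f` is trivial on `ϖ ^ j O`, and the spectral set is the orthogonal of `ϖ ^ j O`
    subst hjn
    have hT : spectralSet ϖ β f j = (lattice ϖ (d - j) : Set K) := by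
      ext y
      rw [h.mem_spectralSet_iff hϖ (y₀ := 0) (fun x hx => ?_), sub_zero, SetLike.mem_coe]
      rw [hn x hx, mul_zero, ← mul_zero x, h.char_eq_one_of_mem hϖ hj hx (zero_mem _), one_mul]
    have hzero : ∀ k, k < j → k < d - j → ∫ x in shell ϖ k, (f x : ℂ) ∂ν = 0 := by
      intro k hk hk'
      rw [h.setIntegral_shell_eq_inter ν hϖ hj hk, hT, Set.eq_empty_of_forall_notMem
        (s := shell ϖ k ∩ (lattice ϖ (d - j) : Set K))
        fun x hx => hϖ.not_mem_lattice_of_mem_shell hx.1 hk' hx.2]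
      simp
    rcases eq_or_lt_of_le hj with hd | hd
    · refine ⟨j, j, le_rfl, fun k hk => hzero k hk (by lia), hbig, fun X hX hP => ?_⟩
      have : (v : ℂ) * (1 - r) * X ^ j ≠ 0 :=
        mul_ne_zero (mul_ne_zero hvC h1r) (zpow_ne_zero _ hX)
      simp [this] at hP
    · have hdj : d - j = j - 1 := by lia
      refine ⟨j - 1, j, by lia, fun k hk => hzero k (by lia) (by lia), hbig, fun X hX hP => ?_⟩
      have hIco : Finset.Ico (j - 1) j = {j - 1} := by
        ext; simp; lia
      rw [hIco, Finset.sum_singleton, setIntegral_shell ν h.continuous hϖ, sub_add_cancel,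
        hlat j le_rfl] at hP
      rw [hT, hdj, hν, hν] at hgauss
      set G := ∫ x in (lattice ϖ (j - 1) : Set K), (f x : ℂ) ∂ν
      have hrj : (r : ℂ) ^ j ≠ 0 := zpow_ne_zero _ hrC
      have hXj : X ^ j ≠ 0 := zpow_ne_zero _ hX
      refine norm_sq_eq_of_gauss hr0 hr1 (τ := G / (r ^ j * v)) ?_ ?_
      · have hrj' : (r : ℝ) ^ j ≠ 0 := (zpow_pos hr0 _).ne'
        rw [norm_div, div_pow, hgauss, norm_mul, norm_zpow, Complex.norm_real, Complex.norm_real,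
          Real.norm_of_nonneg hr0.le, Real.norm_of_nonneg hv.le, zpow_sub_one₀ hr0.ne']
        field_simp
      · rw [neg_sub, zpow_sub₀ hrC, zpow_one, zpow_sub_one₀ hX] at hP
        field_simp at hP ⊢
        refine mul_left_cancel₀ hXj ?_
        linear_combination hP
  · obtain ⟨y₀, hy₀⟩ := h.nonempty_spectralSet hϖ hj ν
    -- the minimality of `n` puts the spectral set into a single sphere
    have hy₀n : y₀ ∈ shell ϖ (d - n) := by
      rw [hϖ.shell_eq_diff]
      constructor
      · refine (h.forall_mem_lattice_iff hϖ).1 fun x hx => ?_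
        have := hy₀ x (hϖ.lattice_le_lattice hjn.le hx)
        rwa [hn x hx, one_mul] at this
      · intro hmem
        have h1 : ∀ x ∈ lattice ϖ (n - 1), f x = 1 := by
          intro x hx
          have h2 := hy₀ x (hϖ.lattice_le_lattice (by lia) hx)
          rwa [(h.forall_mem_lattice_iff hϖ (k := n - 1)).2
            (by rwa [show d - (n - 1) = d - n + 1 by ring]) x hx, mul_one] at h2
        have := hmin (n - 1) ⟨by lia, h1⟩
        lia
    have hT : spectralSet ϖ β f j ⊆ shell ϖ (d - n) := by
      intro y hy
      have := hϖ.add_mem_shell hy₀n (by lia) ((h.mem_spectralSet_iff hϖ hy₀).1 hy)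
      rwa [add_sub_cancel] at this
    have hzero : ∀ k, k < j → k ≠ d - n → ∫ x in shell ϖ k, (f x : ℂ) ∂ν = 0 := by
      intro k hk hk'
      rw [h.setIntegral_shell_eq_inter ν hϖ hj hk, Set.eq_empty_of_forall_notMem
        (s := shell ϖ k ∩ spectralSet ϖ β f j)
        fun x hx => hk' (hϖ.eq_of_mem_shell hx.1 (hT hx.2))]
      simp
    have hmid : ∀ k, j ≤ k → k < n - 1 → ∫ x in shell ϖ k, (f x : ℂ) ∂ν = 0 := by
      intro k hk hk'
      rw [setIntegral_shell ν h.continuous hϖ, hlat0 k hk (by lia), hlat0 (k + 1) (by lia) (by lia),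
        sub_zero]
    refine ⟨d - n, n, by lia, fun k hk => hzero k (by lia) hk.ne, hbig, fun X hX hP => ?_⟩
    have hne : d - n ≠ n - 1 := by lia
    have hsub : ({d - n, n - 1} : Finset ℤ) ⊆ Finset.Ico (d - n) n := by
      intro k hk
      simp only [Finset.mem_insert, Finset.mem_singleton] at hk
      rw [Finset.mem_Ico]
      lia
    rw [← Finset.sum_subset hsub, Finset.sum_pair hne, setIntegral_shell ν h.continuous hϖ (n - 1),
      hlat0 (n - 1) (by lia) (by lia), sub_add_cancel, hlat n le_rfl,
      h.setIntegral_shell_eq_inter ν hϖ hj (by lia), Set.inter_eq_self_of_subset_right hT] at hP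
    · set G := ∫ x in spectralSet ϖ β f j, (f x : ℂ) ∂ν
      obtain ⟨e, he⟩ : ∃ e : ℕ, (e : ℤ) + 1 = 2 * n - d :=
        ⟨(2 * n - d - 1).toNat, by lia⟩
      refine norm_sq_eq_of_two_terms hr0 hr1 hv (e := e) (c := r ^ (-(d - n)) * G) ?_ ?_
      · rw [norm_mul, mul_pow, hgauss, hν, hν, norm_zpow, Complex.norm_real,
          Real.norm_of_nonneg hr0.le]
        have h1 : (r ^ (-(d - n))) ^ 2 * (r ^ (d - j) * r ^ j) = r ^ (e + 1) := by
          rw [← zpow_natCast, ← zpow_natCast, ← zpow_mul, ← zpow_add₀ hr0.ne', ← zpow_add₀ hr0.ne']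
          congr 1
          push_cast
          lia
        rw [← h1]
        ring
      · have hXl : X ^ (d - n) ≠ 0 := zpow_ne_zero _ hX
        have hn1 : X ^ (n - 1) = X ^ (d - n) * X ^ e := by
          rw [← zpow_natCast, ← zpow_add₀ hX]
          congr 1
          lia
        have hn2 : X ^ n = X ^ (n - 1) * X := by
          rw [← zpow_add_one₀ hX, sub_add_cancel]
        have hrn : (r : ℂ) ^ (-(n - 1)) * r ^ n = r := by
          rw [← zpow_add₀ hrC, show -(n - 1) + n = 1 by ring, zpow_one]
        refine mul_left_cancel₀ hXl ?_
        rw [hn2, hn1] at hP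
        linear_combination hP + (1 - X) * X ^ (d - n) * X ^ e * v * hrn
    · intro k hk hk'
      simp only [Finset.mem_insert, Finset.mem_singleton, not_or] at hk'
      rw [Finset.mem_Ico] at hk
      rcases lt_or_ge k j with hkj | hkj
      · rw [hzero k hkj hk'.1, mul_zero, zero_mul]
      · rw [hmid k hkj (by lia), mul_zero, zero_mul]

end IsQuadratic

/-! ### Haar measure on the multiplicative group -/

section Units

variable {K : Type*} [NormedField K]

theorem isOpenEmbedding_unitsVal : Topology.IsOpenEmbedding (Units.val : Kˣ → K) :=
  Units.isOpenEmbedding_val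

theorem continuous_unitsDensity (N : ℕ) : Continuous fun x : Kˣ => (‖(x : K)‖₊ ^ N)⁻¹ :=
  ((continuous_nnnorm.comp Units.continuous_val).pow N).inv₀ fun x => by simp

variable [ProperSpace K]

instance secondCountableTopology_units : SecondCountableTopology Kˣ :=
  isOpenEmbedding_unitsVal.isEmbedding.secondCountableTopology

instance locallyCompactSpace_units : LocallyCompactSpace Kˣ :=
  isOpenEmbedding_unitsVal.locallyCompactSpace

variable [MeasurableSpace K] [BorelSpace K]

omit [ProperSpace K] in
instance borelSpace_units : BorelSpace Kˣ :=
  ⟨by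
    rw [isOpenEmbedding_unitsVal.eq_induced, borel_comap, ← BorelSpace.measurable_eq (α := K)]
    rfl⟩

omit [ProperSpace K] in
theorem measurableEmbedding_unitsVal : MeasurableEmbedding (Units.val : Kˣ → K) :=
  isOpenEmbedding_unitsVal.measurableEmbedding

/-- The measure `‖x‖ ^ (-N) dx` on `Kˣ`, where `dx` is the additive measure `ν`. -/
noncomputable def unitsMeasure (ν : Measure K) (N : ℕ) : Measure Kˣ :=
  (ν.comap Units.val).withDensity fun x => ((‖(x : K)‖₊ ^ N)⁻¹ : ℝ≥0)

variable (ν : Measure K) [ν.IsAddHaarMeasure] {N : ℕ}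

theorem map_mul_left_comap_unitsVal (g : Kˣ) :
    (ν.comap Units.val).map (g * ·) =
      ((distribHaarChar K g : ℝ≥0∞))⁻¹ • ν.comap (Units.val : Kˣ → K) := by
  ext A hA
  rw [Measure.map_apply (measurable_const_mul g) hA, Measure.smul_apply, smul_eq_mul,
    measurableEmbedding_unitsVal.comap_apply, measurableEmbedding_unitsVal.comap_apply]
  have h1 : (Units.val '' ((g * ·) ⁻¹' A) : Set K) = g⁻¹ • (Units.val '' A : Set K) := by
    ext x
    rw [Set.mem_smul_set_iff_inv_smul_mem, inv_inv]
    constructor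
    · rintro ⟨u, hu, rfl⟩
      exact ⟨g * u, hu, by simp [Units.smul_def]⟩
    · rintro ⟨u, hu, hux⟩
      refine ⟨g⁻¹ * u, by simpa using hu, ?_⟩
      rw [Units.val_mul, hux, Units.smul_def, smul_eq_mul, Units.inv_mul_cancel_left]
  rw [h1, ← distribHaarChar_mul ν, map_inv,
    ENNReal.coe_inv (distribHaarChar_pos (A := K) (g := g)).ne']

theorem isHaarMeasure_unitsMeasure
    (hmod : ∀ u : Kˣ, distribHaarChar K u = ‖(u : K)‖₊ ^ N) :
    (unitsMeasure ν N).IsHaarMeasure := by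
  have hc := continuous_unitsDensity (K := K) N
  have hlf : IsLocallyFiniteMeasure (ν.comap (Units.val : Kˣ → K)) := by
    refine ⟨fun x => ?_⟩
    obtain ⟨U, hU, hU'⟩ := ν.exists_isOpen_measure_lt_top (x : K)
    refine ⟨Units.val ⁻¹' U, (hU'.1.preimage Units.continuous_val).mem_nhds hU, ?_⟩
    rw [measurableEmbedding_unitsVal.comap_apply]
    exact (measure_mono (Set.image_preimage_subset _ _)).trans_lt hU'.2
  have hop : (ν.comap (Units.val : Kˣ → K)).IsOpenPosMeasure := by
    refine ⟨fun U hU hne => ?_⟩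
    rw [measurableEmbedding_unitsVal.comap_apply]
    exact ((isOpenEmbedding_unitsVal.isOpenMap U hU).measure_pos ν (hne.image _)).ne'
  have h1 : IsLocallyFiniteMeasure (unitsMeasure ν N) := IsLocallyFiniteMeasure.withDensity_coe hc
  have h2 : (unitsMeasure ν N).IsOpenPosMeasure := by
    refine (withDensity_absolutelyContinuous' (μ := ν.comap (Units.val : Kˣ → K))
      hc.measurable.coe_nnreal_ennreal.aemeasurable
      (Filter.Eventually.of_forall fun x => ?_)).isOpenPosMeasure
    simp
  have h3 : (unitsMeasure ν N).IsMulLeftInvariant := by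
    refine ⟨fun g => ?_⟩
    ext A hA
    rw [Measure.map_apply (measurable_const_mul g) hA, unitsMeasure,
      withDensity_apply _ (hA.preimage (measurable_const_mul g)), withDensity_apply _ hA]
    have h4 : ∀ x : Kˣ, (((‖(x : K)‖₊ ^ N)⁻¹ : ℝ≥0) : ℝ≥0∞) =
        distribHaarChar K g * ((‖((g * x : Kˣ) : K)‖₊ ^ N)⁻¹ : ℝ≥0) := by
      intro x
      rw [hmod, ← ENNReal.coe_mul, Units.val_mul, nnnorm_mul, mul_pow]
      congr 1
      have : ‖(g : K)‖₊ ^ N ≠ 0 := by simp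
      field_simp
    rw [lintegral_congr h4, lintegral_const_mul' _ _ ENNReal.coe_ne_top,
      ← setLIntegral_map (f := fun x : Kˣ => (((‖(x : K)‖₊ ^ N)⁻¹ : ℝ≥0) : ℝ≥0∞)) hA
        hc.measurable.coe_nnreal_ennreal (measurable_const_mul g),
      map_mul_left_comap_unitsVal, Measure.restrict_smul, lintegral_smul_measure, smul_eq_mul,
      ← mul_assoc, ENNReal.mul_inv_cancel, one_mul]
    · exact_mod_cast (distribHaarChar_pos (A := K) (g := g)).ne'
    · exact ENNReal.coe_ne_top
  exact { }

/-- On a sphere, a Haar measure on `Kˣ` is a constant multiple of the additive Haar measure. -/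
theorem exists_setIntegral_units_eq [IsUltrametricDist K] (μ : Measure Kˣ) [μ.IsHaarMeasure]
    (hmod : ∀ u : Kˣ, distribHaarChar K u = ‖(u : K)‖₊ ^ N) {ϖ : K} (hϖ : IsUniformizer ϖ) :
    ∃ C : ℝ, 0 < C ∧ ∀ (k : ℤ) (A : Set K), MeasurableSet A → A ⊆ shell ϖ k → ∀ g : K → ℂ,
      ∫ x in Units.val ⁻¹' A, g (x : Kˣ) ∂μ =
        C * (((‖ϖ‖ ^ N : ℝ) : ℂ) ^ (-k) * ∫ x in A, g x ∂ν) := by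
  have := isHaarMeasure_unitsMeasure ν hmod
  refine ⟨μ.haarScalarFactor (unitsMeasure ν N),
    Measure.haarScalarFactor_pos_of_isHaarMeasure _ _, fun k A hA hAk g => ?_⟩
  have hc := continuous_unitsDensity (K := K) N
  have hA' : MeasurableSet (Units.val ⁻¹' A : Set Kˣ) := measurableEmbedding_unitsVal.measurable hA
  have hrange : A ⊆ Set.range (Units.val : Kˣ → K) := by
    intro x hx
    have : x ≠ 0 := by
      rintro rfl
      have := mem_shell.1 (hAk hx)
      rw [norm_zero] at this
      exact (zpow_pos hϖ.norm_pos k).ne this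
    exact ⟨Units.mk0 x this, rfl⟩
  conv_lhs => rw [Measure.isMulLeftInvariant_eq_smul μ (unitsMeasure ν N)]
  rw [Measure.restrict_smul, integral_smul_nnreal_measure, NNReal.smul_def, Complex.real_smul]
  congr 1
  rw [unitsMeasure, setIntegral_withDensity_eq_setIntegral_smul hc.measurable _ hA']
  have h1 : ∀ x ∈ (Units.val ⁻¹' A : Set Kˣ), (‖(x : K)‖₊ ^ N)⁻¹ • g x =
      ((‖ϖ‖ ^ N : ℝ) : ℂ) ^ (-k) * g x := by
    intro x hx
    rw [NNReal.smul_def, Complex.real_smul]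
    congr 1
    push_cast
    rw [mem_shell.1 (hAk hx)]
    push_cast
    rw [← zpow_natCast, ← zpow_natCast, ← zpow_mul, ← zpow_mul, ← zpow_neg]
    congr 1
    ring
  rw [setIntegral_congr_fun hA' h1, integral_const_mul]
  congr 1
  rw [← measurableEmbedding_unitsVal.setIntegral_map, measurableEmbedding_unitsVal.map_comap,
    Measure.restrict_restrict hA, Set.inter_eq_self_of_subset_left hrange]

end Units

/-! ### Multiplicative convolution and Mellin transforms -/

section Mellin

theorem ofReal_zpow_cpow {r : ℝ} (hr : 0 < r) (k : ℤ) (s : ℂ) :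
    ((r ^ k : ℝ) : ℂ) ^ s = ((r : ℂ) ^ s) ^ k := by
  have h1 : ((r ^ k : ℝ) : ℂ) ≠ 0 := by exact_mod_cast (zpow_pos hr k).ne'
  have h2 : (r : ℂ) ≠ 0 := by exact_mod_cast hr.ne'
  rw [Complex.cpow_def_of_ne_zero h1, Complex.cpow_def_of_ne_zero h2, ← Complex.ofReal_log hr.le,
    ← Complex.ofReal_log (zpow_pos hr k).le, Real.log_zpow, ← Complex.exp_int_mul]
  push_cast
  ring_nf

variable (p : ℕ) [Fact p.Prime] {K : Type*} [NormedField K] [NormedAlgebra ℚ_[p] K]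

theorem normAbs_mul (x y : K) : normAbs p K (x * y) = normAbs p K x * normAbs p K y := by
  rw [normAbs, norm_mul, mul_pow]; rfl

theorem normAbs_units_pos (x : Kˣ) : 0 < normAbs p K x :=
  pow_pos (norm_pos_iff.2 x.ne_zero) _

theorem continuous_normAbs_cpow (s : ℂ) :
    Continuous fun x : Kˣ => (normAbs p K x : ℂ) ^ s := by
  have h1 : Continuous fun x : Kˣ => (normAbs p K x : ℂ) :=
    Complex.continuous_ofReal.comp ((continuous_norm.comp Units.continuous_val).pow _)
  refine h1.cpow continuous_const fun x => ?_
  rw [Complex.ofReal_mem_slitPlane]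
  exact normAbs_units_pos p x

theorem continuous_mellinIntegrand {g : Kˣ → ℂ} (hg : Continuous g) (s : ℂ) :
    Continuous (mellinIntegrand p g s) :=
  hg.mul (continuous_normAbs_cpow p s)

variable [ProperSpace K] [MeasurableSpace K] [BorelSpace K] (μ : Measure Kˣ) [μ.IsHaarMeasure]

/-- The Mellin transform turns multiplicative convolution into multiplication. -/
theorem integrable_mellinIntegrand_mulConv {φ g : Kˣ → ℂ} {s : ℂ}
    (hφ : Integrable (mellinIntegrand p φ s) μ) (hg : Integrable (mellinIntegrand p g s) μ) :
    Integrable (mellinIntegrand p (mulConv μ φ g) s) μ ∧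
      mellinTransform p μ (mulConv μ φ g) s =
        mellinTransform p μ g s * mellinTransform p μ φ s := by
  have h1 : Integrable (fun z : Kˣ × Kˣ => mellinIntegrand p φ s z.1 *
      mellinIntegrand p g s (z.1⁻¹ * z.2)) (μ.prod μ) :=
    (measurePreserving_prod_inv_mul μ μ).integrable_comp_of_integrable (hφ.mul_prod hg)
  have h2 : mellinIntegrand p (mulConv μ φ g) s = fun y => ∫ x, mellinIntegrand p φ s x *
      mellinIntegrand p g s (x⁻¹ * y) ∂μ := by
    ext1 y
    rw [mellinIntegrand, mulConv, ← integral_mul_const]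
    congr 1 with x
    have h3 : normAbs p K (y : K) = normAbs p K (x : K) * normAbs p K ((x⁻¹ * y : Kˣ) : K) := by
      rw [← normAbs_mul, ← Units.val_mul, mul_inv_cancel_left]
    rw [h3, Complex.ofReal_mul, Complex.mul_cpow_ofReal_nonneg (normAbs_units_pos p x).le
      (normAbs_units_pos p (x⁻¹ * y)).le, mellinIntegrand, mellinIntegrand]
    ring
  rw [mellinTransform, h2]
  refine ⟨h1.integral_prod_right, ?_⟩
  rw [← integral_integral_swap h1, mellinTransform, mellinTransform, mul_comm,
    ← integral_mul_const]
  congr 1 with x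
  rw [integral_const_mul, integral_mul_left_eq_self]

end Mellin

/-! ### Truncation of the convolution with a test function -/

section Truncation

variable {K : Type*} [NormedField K] [IsUltrametricDist K] {ϖ : K}

/-- The preimage in `Kˣ` of the coset `1 + ϖ ^ m O`. -/
def congrUnits (ϖ : K) (m : ℤ) : Set Kˣ := {u | (u : K) - 1 ∈ lattice ϖ m}

theorem IsUniformizer.norm_eq_one_of_mem_congrUnits (hϖ : IsUniformizer ϖ) {m : ℤ} (hm : 0 < m)
    {u : Kˣ} (hu : u ∈ congrUnits ϖ m) : ‖(u : K)‖ = 1 := by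
  have h1 : (1 : K) ∈ shell ϖ 0 := by simp [mem_shell]
  have := hϖ.add_mem_shell h1 hm hu
  rwa [add_sub_cancel, mem_shell, zpow_zero] at this

theorem IsUniformizer.inv_mem_congrUnits (hϖ : IsUniformizer ϖ) {m : ℤ} (hm : 0 < m)
    {u : Kˣ} (hu : u ∈ congrUnits ϖ m) : u⁻¹ ∈ congrUnits ϖ m := by
  have h1 := hϖ.norm_eq_one_of_mem_congrUnits hm hu
  have h2 : ((u⁻¹ : Kˣ) : K) - 1 = -((u : K)⁻¹ * ((u : K) - 1)) := by
    rw [Units.val_inv_eq_inv_val, mul_sub, inv_mul_cancel₀ u.ne_zero]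
    ring
  change _ ∈ lattice ϖ m
  rw [h2, neg_mem_iff, mem_lattice, norm_mul, norm_inv, h1, inv_one, one_mul]
  exact hu

/-- A test function on `Kˣ` is invariant under a neighbourhood `1 + ϖ ^ m O` of `1`. -/
theorem IsUniformizer.exists_forall_mul_eq (hϖ : IsUniformizer ϖ) {φ : Kˣ → ℂ}
    (hφ : IsLocallyConstant φ) (hc : HasCompactSupport φ) :
    ∃ m : ℤ, 0 < m ∧ ∀ u ∈ congrUnits ϖ m, ∀ x, φ (x * u) = φ x := by
  have h1 : ∀ᶠ u in nhds (1 : Kˣ), ∀ x ∈ tsupport φ, φ (x * u) = φ x := by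
    refine hc.isCompact.eventually_forall_of_forall_eventually fun x _ => ?_
    have hcont : Continuous fun z : Kˣ × Kˣ => z.2 * z.1 := by fun_prop
    have h2 : ∀ᶠ z : Kˣ × Kˣ in nhds (1, x), φ (z.2 * z.1) = φ (x * 1) :=
      (hφ.comp_continuous hcont).eventually_eq (1, x)
    have h3 : ∀ᶠ z : Kˣ × Kˣ in nhds (1, x), φ z.2 = φ x :=
      (hφ.comp_continuous continuous_snd).eventually_eq (1, x)
    filter_upwards [h2, h3] with z hz2 hz3
    rw [hz2, hz3, mul_one]
  rw [isOpenEmbedding_unitsVal.nhds_eq_comap, Filter.eventually_comap] at h1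
  have h2 : (fun t : K => t + 1) ⁻¹' {b | ∀ a : Kˣ, (a : K) = b →
      ∀ x ∈ tsupport φ, φ (x * a) = φ x} ∈ nhds (0 : K) := by
    refine (Continuous.continuousAt (by fun_prop)).preimage_mem_nhds ?_
    rw [zero_add]
    exact h1
  obtain ⟨k, hk⟩ := hϖ.exists_lattice_subset h2
  have h3 : ∀ u ∈ congrUnits ϖ (max k 1), ∀ x ∈ tsupport φ, φ (x * u) = φ x := by
    intro u hu
    have := hk (hϖ.lattice_le_lattice (le_max_left k 1) hu)
    exact this u (by simp)
  refine ⟨max k 1, by lia, fun u hu x => ?_⟩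
  by_cases hx : x ∈ tsupport φ
  · exact h3 u hu x hx
  · rw [image_eq_zero_of_notMem_tsupport hx]
    by_contra hne
    have := h3 _ (hϖ.inv_mem_congrUnits (by lia) hu) (x * u) (subset_tsupport _ hne)
    rw [mul_inv_cancel_right, image_eq_zero_of_notMem_tsupport hx] at this
    exact hne this.symm

variable [ProperSpace K] [MeasurableSpace K] [BorelSpace K]

/-- The oscillation of `f` makes its averages over small multiplicative cosets vanish far away. -/
theorem IsQuadratic.exists_setIntegral_congrUnits_eq_zero {d : ℤ} {β f : K → Circle}
    (h : IsQuadratic ϖ d β f) (hϖ : IsUniformizer ϖ) (μ : Measure Kˣ) [μ.IsHaarMeasure] {N : ℕ}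
    (hmod : ∀ u : Kˣ, distribHaarChar K u = ‖(u : K)‖₊ ^ N) {m : ℤ} (hm : 0 < m) :
    ∃ l₀ : ℤ, ∀ z : Kˣ, (z : K) ∉ lattice ϖ l₀ →
      ∫ u in congrUnits ϖ m, (f ((u * z : Kˣ) : K) : ℂ) ∂μ = 0 := by
  let ν : Measure K := Measure.addHaar
  obtain ⟨C, -, hC⟩ := exists_setIntegral_units_eq ν μ hmod hϖ
  obtain ⟨j, hj⟩ : ∃ j : ℤ, d ≤ 2 * j := ⟨|d|, by
    have := le_abs_self d
    have := abs_nonneg d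
    lia⟩
  obtain ⟨k₀, hk₀⟩ := h.exists_spectralSet_subset hϖ j
  refine ⟨min k₀ (j - m), fun z hz => ?_⟩
  obtain ⟨k, hk⟩ := hϖ.exists_mem_shell z.ne_zero
  have hlt : k < min k₀ (j - m) := by
    by_contra! hle
    exact hz (hϖ.lattice_le_lattice hle (le_of_eq hk))
  -- multiplication by `z` carries `1 + ϖ ^ m O` to `A`
  let A : Set K := {x | x - z ∈ lattice ϖ (k + m)}
  have hA : MeasurableSet A :=
    ((isClosed_lattice (k + m)).preimage (continuous_id.sub continuous_const)).measurableSet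
  have hAk : A ⊆ shell ϖ k := by
    intro x hx
    have := hϖ.add_mem_shell hk (show k < k + m by lia) hx
    rwa [add_sub_cancel] at this
  have hU : MeasurableSet (congrUnits ϖ m) :=
    ((isClosed_lattice m).preimage (Units.continuous_val.sub continuous_const)).measurableSet
  have hmem : ∀ u : Kˣ, u * z ∈ (Units.val ⁻¹' A : Set Kˣ) ↔ u ∈ congrUnits ϖ m := by
    intro u
    change (((u * z : Kˣ) : K) - z ∈ lattice ϖ (k + m)) ↔ (u : K) - 1 ∈ lattice ϖ m
    have h2 : ((u * z : Kˣ) : K) - z = z * ((u : K) - 1) := by rw [Units.val_mul]; ring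
    rw [h2, mem_lattice, mem_lattice, norm_mul, mem_shell.1 hk, zpow_add₀ hϖ.norm_pos.ne']
    exact mul_le_mul_iff_of_pos_left (zpow_pos hϖ.norm_pos k)
  have h1 : ∫ u in congrUnits ϖ m, (f ((u * z : Kˣ) : K) : ℂ) ∂μ =
      ∫ x in Units.val ⁻¹' A, (f ((x : Kˣ) : K) : ℂ) ∂μ := by
    rw [← integral_indicator hU, ← integral_indicator
      (measurableEmbedding_unitsVal.measurable hA), ← integral_mul_right_eq_self
      ((Units.val ⁻¹' A).indicator fun x : Kˣ => (f (x : K) : ℂ)) z]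
    congr 1 with u
    by_cases hu : u ∈ congrUnits ϖ m
    · rw [Set.indicator_of_mem hu, Set.indicator_of_mem ((hmem u).2 hu)]
    · rw [Set.indicator_of_notMem hu, Set.indicator_of_notMem ((hmem u).not.2 hu)]
  rw [h1, hC k A hA hAk (fun x => f x), h.setIntegral_eq_inter ν hϖ hj hA
    (measure_ne_top_of_subset (hAk.trans (by rw [hϖ.shell_eq_diff]; exact Set.sdiff_subset))
      (IsQuadratic.measure_lattice_ne_top ν k)) fun x hx y => ?_,
    Set.eq_empty_of_forall_notMem (s := A ∩ spectralSet ϖ β f j) fun x hx => ?_]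
  · simp
  · exact hϖ.not_mem_lattice_of_mem_shell (hAk hx.1) (by lia) (hk₀ hx.2)
  · change x + y - z ∈ lattice ϖ (k + m) ↔ y - z ∈ lattice ϖ (k + m)
    rw [add_sub_assoc]
    exact AddSubgroup.add_mem_cancel_left _ (hϖ.lattice_le_lattice (by lia) hx)

omit [MeasurableSpace K] [BorelSpace K] in
theorem isCompact_preimage_shell (hϖ : IsUniformizer ϖ) (k : ℤ) :
    IsCompact (Units.val ⁻¹' shell ϖ k : Set Kˣ) := by
  refine (isOpenEmbedding_unitsVal.isInducing.isCompact_preimage_iff fun x hx => ?_).2 ?_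
  · have : x ≠ 0 := by
      rintro rfl
      have := mem_shell.1 hx
      rw [norm_zero] at this
      exact (zpow_pos hϖ.norm_pos k).ne this
    exact ⟨Units.mk0 x this, rfl⟩
  · rw [hϖ.shell_eq_diff]
    exact (isCompact_lattice k).diff (hϖ.isOpen_lattice _)

omit [ProperSpace K] [MeasurableSpace K] [BorelSpace K] in
theorem isOpen_congrUnits (hϖ : IsUniformizer ϖ) (m : ℤ) : IsOpen (congrUnits ϖ m) :=
  (hϖ.isOpen_lattice m).preimage (Units.continuous_val.sub continuous_const)

/-- Convolution with a test function only sees the restriction of `f` to a bounded set. -/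
theorem IsQuadratic.exists_mulConv_eq {d : ℤ} {β f : K → Circle}
    (h : IsQuadratic ϖ d β f) (hϖ : IsUniformizer ϖ) (μ : Measure Kˣ) [μ.IsHaarMeasure] {N : ℕ}
    (hmod : ∀ u : Kˣ, distribHaarChar K u = ‖(u : K)‖₊ ^ N) {φ : Kˣ → ℂ}
    (hφ : IsLocallyConstant φ) (hc : HasCompactSupport φ) :
    ∃ l₀ : ℤ, ∀ l ≤ l₀, mulConv μ φ (fun x => (f x : ℂ)) = mulConv μ φ
      ((Units.val ⁻¹' (lattice ϖ l : Set K)).indicator fun x => (f x : ℂ)) := by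
  obtain ⟨m, hm, hinv⟩ := hϖ.exists_forall_mul_eq hφ hc
  obtain ⟨l₀, hl₀⟩ := h.exists_setIntegral_congrUnits_eq_zero hϖ μ hmod hm
  refine ⟨l₀, fun l hl => ?_⟩
  ext1 y
  set F : Kˣ → ℂ := fun x => (f x : ℂ)
  set W : Set Kˣ := Units.val ⁻¹' (lattice ϖ l : Set K)
  set U : Set Kˣ := congrUnits ϖ m
  have hF : Measurable F :=
    (continuous_subtype_val.comp (h.continuous.comp Units.continuous_val)).measurable
  have hW : MeasurableSet W :=
    measurableEmbedding_unitsVal.measurable (IsQuadratic.measurableSet_lattice l)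
  have hFb : ∀ x, ‖F x‖ ≤ 1 := fun x => (Circle.norm_coe _).le
  have hU : MeasurableSet U := (isOpen_congrUnits hϖ m).measurableSet
  have hUtop : μ U ≠ ∞ := by
    suffices hsub : U ⊆ Units.val ⁻¹' shell ϖ 0 from
      measure_ne_top_of_subset hsub (isCompact_preimage_shell hϖ 0).measure_ne_top
    intro u hu
    change _ = _
    rw [zpow_zero]
    exact hϖ.norm_eq_one_of_mem_congrUnits hm hu
  have hU0 : μ.real U ≠ 0 := by
    refine (ENNReal.toReal_pos ((isOpen_congrUnits hϖ m).measure_pos μ ⟨1, ?_⟩).ne' hUtop).ne'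
    change ((1 : Kˣ) : K) - 1 ∈ lattice ϖ m
    rw [Units.val_one, sub_self]
    exact zero_mem _
  have hφi : Integrable φ μ := hφ.continuous.integrable_of_hasCompactSupport hc
  have hbound : ∀ (V : Set Kˣ) (x : Kˣ), ‖V.indicator F x‖ ≤ 1 := fun V x =>
    (norm_indicator_le_norm_self F x).trans (hFb x)
  have hint : ∀ V, MeasurableSet V → Integrable (fun x => φ x * V.indicator F (x⁻¹ * y)) μ := by
    intro V hV
    have := hφi.bdd_mul (f := fun x => V.indicator F (x⁻¹ * y)) (c := 1)
      ((hF.indicator hV).comp (measurable_inv.mul_const y)).aestronglyMeasurable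
      (Filter.Eventually.of_forall fun x => hbound V _)
    simpa only [mul_comm] using this
  have hsplit : mulConv μ φ F y = mulConv μ φ (W.indicator F) y +
      ∫ x, φ x * Wᶜ.indicator F (x⁻¹ * y) ∂μ := by
    rw [mulConv, mulConv, ← integral_add (hint W hW) (hint Wᶜ hW.compl)]
    congr 1 with x
    rw [← mul_add, ← Pi.add_apply, Set.indicator_self_add_compl]
  -- as `φ` is invariant under `U`, the integral may be averaged over translations by `U`
  have htrans : ∀ u ∈ U, ∫ x, Wᶜ.indicator F (u * (x⁻¹ * y)) * φ x ∂μ =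
      ∫ x, φ x * Wᶜ.indicator F (x⁻¹ * y) ∂μ := by
    intro u hu
    rw [← integral_mul_right_eq_self (fun x => φ x * Wᶜ.indicator F (x⁻¹ * y)) u⁻¹]
    congr 1 with x
    rw [hinv _ (hϖ.inv_mem_congrUnits hm hu), mul_inv_rev, inv_inv, mul_assoc, mul_comm]
  -- for `z` in `W` the integrand is zero, otherwise the integral is the average of `f` around `z`
  have hvanish : ∀ z : Kˣ, ∫ u in U, Wᶜ.indicator F (u * z) ∂μ = 0 := by
    intro z
    have hmem : ∀ u ∈ U, u * z ∈ W ↔ z ∈ W := by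
      intro u hu
      change ‖((u * z : Kˣ) : K)‖ ≤ _ ↔ ‖(z : K)‖ ≤ _
      rw [Units.val_mul, norm_mul, hϖ.norm_eq_one_of_mem_congrUnits hm hu, one_mul]
    by_cases hz : z ∈ W
    · refine setIntegral_eq_zero_of_forall_eq_zero fun u hu => ?_
      exact Set.indicator_of_notMem (Set.notMem_compl_iff.2 ((hmem u hu).2 hz)) _
    · rw [← hl₀ z fun hz' => hz (hϖ.lattice_le_lattice hl hz')]
      refine setIntegral_congr_fun hU fun u hu => ?_
      exact Set.indicator_of_mem (Set.mem_compl fun hn => hz ((hmem u hu).1 hn)) _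
  have hzero : (μ.real U : ℂ) * ∫ x, φ x * Wᶜ.indicator F (x⁻¹ * y) ∂μ = 0 := by
    have hfin : IsFiniteMeasure (μ.restrict U) := ⟨by simpa using hUtop.lt_top⟩
    calc _ = ∫ u in U, ∫ x, Wᶜ.indicator F (u * (x⁻¹ * y)) * φ x ∂μ ∂μ := by
          rw [setIntegral_congr_fun hU htrans]
          simp
      _ = ∫ x, ∫ u in U, Wᶜ.indicator F (u * (x⁻¹ * y)) * φ x ∂μ ∂μ := by
          refine integral_integral_swap ?_
          have h1 : Integrable (fun z : Kˣ × Kˣ => (1 : ℂ) * φ z.2) ((μ.restrict U).prod μ) :=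
            (integrable_const (1 : ℂ)).mul_prod hφi
          simp only [one_mul] at h1
          refine h1.bdd_mul (c := 1) (Measurable.aestronglyMeasurable ?_)
            (Filter.Eventually.of_forall fun z => hbound Wᶜ _)
          exact (hF.indicator hW.compl).comp
            (measurable_fst.mul (measurable_snd.inv.mul_const y))
      _ = 0 := by
          simp_rw [integral_mul_const, hvanish, zero_mul, integral_zero]
  rw [hsplit, (mul_eq_zero.1 hzero).resolve_left (by exact_mod_cast hU0), add_zero]

end Truncation

/-! ### The weak Mellin transform of a quadratic character -/

section WeakTransform

/-- A Laurent series with eventually constant coefficients is a rational function. -/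
theorem hasSum_shells {c : ℤ → ℂ} {M X : ℂ} {l l' n : ℤ} (hll' : l' ≤ l) (hln : l ≤ n)
    (hcl : ∀ k < l, c k = 0) (hcn : ∀ k, n ≤ k → c k = M) (hX0 : X ≠ 0) (hX1 : ‖X‖ < 1) :
    HasSum (fun i : ℕ => c (l' + i) * X ^ (l' + i : ℤ))
      (∑ k ∈ Finset.Ico l n, c k * X ^ k + M * X ^ n / (1 - X)) := by
  obtain ⟨t, ht⟩ : ∃ t : ℕ, l' + t = n := ⟨(n - l').toNat, by lia⟩
  have htail : HasSum (fun i : ℕ => c (l' + (i + t : ℕ)) * X ^ (l' + (i + t : ℕ) : ℤ))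
      (M * X ^ n / (1 - X)) := by
    have h1 : ∀ i : ℕ, c (l' + (i + t : ℕ)) * X ^ (l' + (i + t : ℕ) : ℤ) =
        M * X ^ n * X ^ i := by
      intro i
      have h2 : l' + ((i + t : ℕ) : ℤ) = n + i := by
        push_cast
        lia
      rw [h2, hcn _ (by lia), zpow_add₀ hX0, zpow_natCast, mul_assoc]
    simp_rw [h1, div_eq_mul_inv]
    exact (hasSum_geometric_of_norm_lt_one hX1).mul_left _
  have h1 : ∑ k ∈ Finset.Ico l n, c k * X ^ k =
      ∑ i ∈ Finset.range t, c (l' + i) * X ^ (l' + i : ℤ) := by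
    have h2 : ∀ k ∈ Finset.Ico l' n, k ∉ Finset.Ico l n → c k * X ^ k = 0 := by
      intro k hk hk'
      rw [Finset.mem_Ico] at hk hk'
      rw [hcl k (by lia), zero_mul]
    rw [Finset.sum_subset (Finset.Ico_subset_Ico_left hll') h2]
    refine Finset.sum_nbij' (fun k => (k - l').toNat) (fun i => l' + (i : ℤ)) ?_ ?_ ?_ ?_ ?_
    · intro k hk
      simp only [Finset.mem_Ico, Finset.mem_range] at hk ⊢
      lia
    · intro i hi
      simp only [Finset.mem_Ico, Finset.mem_range] at hi ⊢
      lia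
    · intro k hk
      simp only [Finset.mem_Ico] at hk
      lia
    · intro i _
      lia
    · intro k hk
      simp only [Finset.mem_Ico] at hk
      rw [show l' + ((k - l').toNat : ℤ) = k by lia]
  rw [h1, add_comm]
  exact (_root_.hasSum_nat_add_iff t).1 htail

variable (p : ℕ) [Fact p.Prime] {K : Type*} [NormedField K] [NormedAlgebra ℚ_[p] K]
  [IsUltrametricDist K] {ϖ : K}

omit [IsUltrametricDist K] in
theorem normAbs_cpow_of_mem_shell (hϖ : IsUniformizer ϖ) {k : ℤ} {x : K} (hx : x ∈ shell ϖ k)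
    (s : ℂ) : (normAbs p K x : ℂ) ^ s = ((normAbs p K ϖ : ℂ) ^ s) ^ k := by
  have h0 : 0 < normAbs p K ϖ := pow_pos hϖ.norm_pos _
  rw [← ofReal_zpow_cpow h0, normAbs, normAbs, mem_shell.1 hx,
    ← zpow_natCast, ← zpow_natCast, zpow_comm]

variable [ProperSpace K] [MeasurableSpace K] [BorelSpace K]

/-- The Mellin transform of the restriction of `f` to `ϖ ^ l' O`, summed sphere by sphere. -/
theorem mellin_indicator_lattice {f : K → Circle} (hf : Continuous f) (hϖ : IsUniformizer ϖ)
    (μ : Measure Kˣ) [μ.IsHaarMeasure] {M : ℂ} {c : ℤ → ℂ} {l l' n : ℤ} (hll' : l' ≤ l)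
    (hln : l ≤ n) {V : ℝ} (hV : ∀ k, μ.real (Units.val ⁻¹' shell ϖ k) = V)
    (hc : ∀ k, ∫ x in Units.val ⁻¹' shell ϖ k, (f ((x : Kˣ) : K) : ℂ) ∂μ = c k)
    (hcl : ∀ k < l, c k = 0) (hcn : ∀ k, n ≤ k → c k = M) (hr : normAbs p K ϖ < 1) {s : ℂ}
    (hs : 0 < s.re) :
    Integrable (mellinIntegrand p ((Units.val ⁻¹' (lattice ϖ l' : Set K)).indicator
      fun x => (f x : ℂ)) s) μ ∧
    mellinTransform p μ ((Units.val ⁻¹' (lattice ϖ l' : Set K)).indicator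
      fun x => (f x : ℂ)) s =
      ∑ k ∈ Finset.Ico l n, c k * ((normAbs p K ϖ : ℂ) ^ s) ^ k +
        M * ((normAbs p K ϖ : ℂ) ^ s) ^ n / (1 - (normAbs p K ϖ : ℂ) ^ s) := by
  set F : Kˣ → ℂ := fun x => (f x : ℂ)
  set W : Set Kˣ := Units.val ⁻¹' (lattice ϖ l' : Set K)
  set r := normAbs p K ϖ
  set X : ℂ := (r : ℂ) ^ s
  have hr0 : 0 < r := pow_pos hϖ.norm_pos _
  have hX0 : X ≠ 0 := by
    rw [← norm_pos_iff, Complex.norm_cpow_eq_rpow_re_of_pos hr0]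
    exact Real.rpow_pos_of_pos hr0 _
  have hX1 : ‖X‖ < 1 := by
    rw [Complex.norm_cpow_eq_rpow_re_of_pos hr0]
    exact Real.rpow_lt_one hr0.le hr hs
  have hF : Continuous F := continuous_subtype_val.comp (hf.comp Units.continuous_val)
  have hW : MeasurableSet W :=
    measurableEmbedding_unitsVal.measurable (IsQuadratic.measurableSet_lattice l')
  let S : ℕ → Set Kˣ := fun i => Units.val ⁻¹' shell ϖ (l' + i)
  have hS : ∀ i, MeasurableSet (S i) := fun i => by
    refine measurableEmbedding_unitsVal.measurable ?_
    rw [hϖ.shell_eq_diff]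
    exact (IsQuadratic.measurableSet_lattice _).diff (IsQuadratic.measurableSet_lattice _)
  have hWS : W = ⋃ i, S i := by
    ext x
    simp only [Set.mem_iUnion]
    constructor
    · intro hx
      obtain ⟨k, hk⟩ := hϖ.exists_mem_shell x.ne_zero
      have hkl : l' ≤ k := by
        by_contra! hlt
        exact hϖ.not_mem_lattice_of_mem_shell hk hlt hx
      refine ⟨(k - l').toNat, ?_⟩
      change (x : K) ∈ shell ϖ _
      rwa [show l' + ((k - l').toNat : ℤ) = k by lia]
    · rintro ⟨i, hi⟩
      exact hϖ.lattice_le_lattice (show l' ≤ l' + i by lia) (le_of_eq hi)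
  have hdisj : Pairwise (Function.onFun Disjoint S) := by
    intro i i' hne
    refine Set.disjoint_left.2 fun x hx hx' => hne ?_
    have := hϖ.eq_of_mem_shell hx hx'
    lia
  have hG : mellinIntegrand p (W.indicator F) s = W.indicator (mellinIntegrand p F s) := by
    ext x
    by_cases hx : x ∈ W
    · simp [mellinIntegrand, hx]
    · simp [mellinIntegrand, hx]
  have hGS : ∀ i, ∀ x ∈ S i, mellinIntegrand p F s x = F x * X ^ (l' + i : ℤ) := by
    intro i x hx
    rw [mellinIntegrand, normAbs_cpow_of_mem_shell p hϖ hx]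
  have hint : IntegrableOn (mellinIntegrand p F s) (⋃ i, S i) μ := by
    refine integrableOn_iUnion_of_summable_integral_norm (fun i => ?_) ?_
    · exact (continuous_mellinIntegrand p hF s).continuousOn.integrableOn_compact
        (isCompact_preimage_shell hϖ _)
    · have h1 : ∀ i : ℕ, ∫ x in S i, ‖mellinIntegrand p F s x‖ ∂μ =
          V * ‖X‖ ^ l' * ‖X‖ ^ i := by
        intro i
        have h2 : ∀ x ∈ S i, ‖mellinIntegrand p F s x‖ = ‖X‖ ^ l' * ‖X‖ ^ i := by
          intro x hx
          rw [hGS i x hx, norm_mul, Circle.norm_coe, one_mul, norm_zpow,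
            zpow_add₀ (norm_ne_zero_iff.2 hX0), zpow_natCast]
        rw [setIntegral_congr_fun (hS i) h2, setIntegral_const, hV, smul_eq_mul, mul_assoc]
      simp_rw [h1]
      exact (summable_geometric_of_lt_one (norm_nonneg X) hX1).mul_left _
  refine ⟨by rw [hG, integrable_indicator_iff hW, hWS]; exact hint, ?_⟩
  have hsum := hasSum_integral_iUnion hS hdisj hint
  have hterm : ∀ i : ℕ, ∫ x in S i, mellinIntegrand p F s x ∂μ =
      c (l' + i) * X ^ (l' + i : ℤ) := by
    intro i
    rw [setIntegral_congr_fun (hS i) (hGS i), integral_mul_const, hc]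
  simp_rw [hterm] at hsum
  rw [mellinTransform, hG, integral_indicator hW, hWS]
  exact hsum.unique (hasSum_shells hll' hln hcl hcn hX0 hX1)

end WeakTransform

open Topology Filter

/-! ### The standard character and the functions `ψ(½ a x² + b x)` -/

section StandardCharacter

theorem exists_int_eq_of_norm_le_one (p : ℕ) [hp : Fact p.Prime] {r : ℚ}
    (hr : ∃ (n : ℤ) (k : ℕ), r = n / (p : ℚ) ^ k) (h : ‖(r : ℚ_[p])‖ ≤ 1) : ∃ z : ℤ, r = z := by
  obtain ⟨n, k, rfl⟩ := hr
  have hp0 : (p : ℚ) ≠ 0 := by exact_mod_cast hp.out.ne_zero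
  have hpR : 0 < (p : ℝ) ^ k := pow_pos (by exact_mod_cast hp.out.pos) k
  push_cast at h
  rw [norm_div, norm_pow, Padic.norm_p, inv_pow, div_inv_eq_mul] at h
  have h1 : ‖(n : ℚ_[p])‖ ≤ (p : ℝ) ^ (-k : ℤ) := by
    rw [zpow_neg, zpow_natCast, ← one_div]
    exact (le_div_iff₀ hpR).2 h
  obtain ⟨z, hz⟩ := (Padic.norm_int_le_pow_iff_dvd n k).1 h1
  refine ⟨z, ?_⟩
  rw [hz]
  push_cast
  field_simp

theorem polarPart_spec (p : ℕ) [Fact p.Prime] (x : ℚ_[p]) :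
    (∃ (n : ℤ) (k : ℕ), polarPart p x = n / (p : ℚ) ^ k) ∧
      ‖(polarPart p x : ℚ_[p]) - x‖ ≤ 1 :=
  (exists_polarPart p x).choose_spec

theorem circleExp_two_pi_mul_int (z : ℤ) : Circle.exp (2 * Real.pi * ((z : ℚ) : ℝ)) = 1 := by
  rw [mul_comm, Rat.cast_intCast, Circle.periodic_exp.int_mul_eq z, Circle.exp_zero]

theorem stdCharPadic_eq_one (p : ℕ) [hp : Fact p.Prime] {x : ℚ_[p]} (hx : ‖x‖ ≤ 1) :
    stdCharPadic p x = 1 := by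
  obtain ⟨h1, h2⟩ := polarPart_spec p x
  have h3 : ‖(polarPart p x : ℚ_[p])‖ ≤ 1 := by
    have := (IsUltrametricDist.norm_add_le_max ((polarPart p x : ℚ_[p]) - x) x).trans
      (max_le h2 hx)
    rwa [sub_add_cancel] at this
  obtain ⟨z, hz⟩ := exists_int_eq_of_norm_le_one p h1 h3
  rw [stdCharPadic, hz, circleExp_two_pi_mul_int]

theorem stdCharPadic_add (p : ℕ) [hp : Fact p.Prime] (x y : ℚ_[p]) :
    stdCharPadic p (x + y) = stdCharPadic p x * stdCharPadic p y := by
  obtain ⟨⟨n₁, k₁, h₁⟩, h₁'⟩ := polarPart_spec p x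
  obtain ⟨⟨n₂, k₂, h₂⟩, h₂'⟩ := polarPart_spec p y
  obtain ⟨⟨n₃, k₃, h₃⟩, h₃'⟩ := polarPart_spec p (x + y)
  have hp0 : (p : ℚ) ≠ 0 := by exact_mod_cast hp.out.ne_zero
  obtain ⟨z, hz⟩ := exists_int_eq_of_norm_le_one p
    (r := polarPart p (x + y) - (polarPart p x + polarPart p y))
    ⟨n₃ * p ^ (k₁ + k₂) - (n₁ * p ^ (k₂ + k₃) + n₂ * p ^ (k₁ + k₃)), k₁ + k₂ + k₃, by
      rw [h₁, h₂, h₃]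
      push_cast
      field_simp
      ring⟩ (by
      have h : ((polarPart p (x + y) - (polarPart p x + polarPart p y) : ℚ) : ℚ_[p]) =
          ((polarPart p (x + y) : ℚ_[p]) - (x + y)) - (((polarPart p x : ℚ_[p]) - x) +
            ((polarPart p y : ℚ_[p]) - y)) := by
        push_cast
        ring
      rw [h, sub_eq_add_neg]
      refine (IsUltrametricDist.norm_add_le_max _ _).trans (max_le h₃' ?_)
      rw [norm_neg]
      exact (IsUltrametricDist.norm_add_le_max _ _).trans (max_le h₁' h₂'))
  have h : polarPart p (x + y) = polarPart p x + polarPart p y + z := by rw [← hz]; ring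
  rw [stdCharPadic, stdCharPadic, stdCharPadic, h, ← Circle.exp_add]
  push_cast
  rw [mul_add, mul_add, Circle.exp_add, ← Rat.cast_intCast (α := ℝ) z, circleExp_two_pi_mul_int,
    mul_one]

variable (p : ℕ) [Fact p.Prime] {K : Type*} [NormedField K] [NormedAlgebra ℚ_[p] K]

theorem stdChar_add (x y : K) : stdChar p K (x + y) = stdChar p K x * stdChar p K y := by
  rw [stdChar, map_add, stdCharPadic_add]; rfl

theorem stdChar_eventually_eq_one [FiniteDimensional ℚ_[p] K] :
    ∀ᶠ x in 𝓝 (0 : K), stdChar p K x = 1 := by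
  have h1 : Continuous (Algebra.trace ℚ_[p] K) := LinearMap.continuous_of_finiteDimensional _
  have h2 : ∀ᶠ x in 𝓝 (0 : K), Algebra.trace ℚ_[p] K x ∈ closedBall (0 : ℚ_[p]) 1 :=
    h1.continuousAt.preimage_mem_nhds (by
      rw [map_zero]
      exact closedBall_mem_nhds _ one_pos)
  filter_upwards [h2] with x hx
  exact stdCharPadic_eq_one p (by simpa using hx)

theorem charZero_of_padic (p : ℕ) [Fact p.Prime] (K : Type*) [NormedField K]
    [NormedAlgebra ℚ_[p] K] : CharZero K :=
  charZero_of_injective_algebraMap (algebraMap ℚ_[p] K).injective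

theorem quadChar_add (a b x y : K) :
    quadChar p K a b (x + y) = quadChar p K a b x * quadChar p K a b y *
      stdChar p K (a * (x * y)) := by
  have := charZero_of_padic p K
  rw [quadChar, quadChar, quadChar, ← stdChar_add, ← stdChar_add]
  congr 1
  have : (2 : K) ≠ 0 := two_ne_zero
  field_simp
  ring

/-- A non-degenerate function `ψ(½ a x² + b x)` satisfies the hypotheses of the abstract theory. -/
theorem exists_isQuadratic_quadChar [FiniteDimensional ℚ_[p] K] [IsUltrametricDist K] {ϖ : K}
    (hϖ : IsUniformizer ϖ) {a b : K}
    (hf : IsNondegenerateSecondDegreeCharacter (quadChar p K a b)) :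
    ∃ d, IsQuadratic ϖ d (fun y => stdChar p K (a * y)) (quadChar p K a b) := by
  have hψ := stdChar_eventually_eq_one p (K := K)
  have hβ0 : ∀ᶠ y in 𝓝 (0 : K), stdChar p K (a * y) = 1 := by
    have h1 : Tendsto (fun y : K => a * y) (𝓝 0) (𝓝 0) := by
      have : Continuous fun y : K => a * y := by fun_prop
      simpa using this.tendsto 0
    exact h1.eventually hψ
  have hf0 : ∀ᶠ x in 𝓝 (0 : K), quadChar p K a b x = 1 := by
    have h1 : Tendsto (fun x : K => 1 / 2 * a * x ^ 2 + b * x) (𝓝 0) (𝓝 0) := by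
      have : Continuous fun x : K => 1 / 2 * a * x ^ 2 + b * x := by fun_prop
      simpa using this.tendsto 0
    exact h1.eventually hψ
  -- if the bicharacter were trivial, then so would be the isomorphism onto the dual of `K`
  have hne : ∃ z : K, stdChar p K (a * z) ≠ 1 := by
    by_contra! htriv
    obtain ⟨ϱ, hϱ⟩ := hf.exists_iso
    have h1 : ∀ y : K, ϱ (Multiplicative.ofAdd y) = ϱ (Multiplicative.ofAdd 0) := by
      intro y
      refine DFunLike.ext _ _ fun x => ?_
      have h2 : ∀ y : K, ϱ (Multiplicative.ofAdd y) x = 1 := by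
        intro y
        have h3 := hϱ x.toAdd y
        rw [defect, quadChar_add, htriv, mul_one, mul_assoc, ← mul_inv, mul_inv_cancel] at h3
        exact h3.symm
      rw [h2, h2]
    exact one_ne_zero (Multiplicative.ofAdd.injective (ϱ.injective (h1 1)))
  obtain ⟨z, hz⟩ := hne
  obtain ⟨kz, hkz⟩ := hϖ.exists_mem_lattice z
  obtain ⟨k, hk⟩ := hϖ.exists_lattice_subset hβ0
  obtain ⟨d, hd, hmin⟩ := Int.exists_least_of_bdd
    (P := fun d => ∀ x ∈ lattice ϖ d, stdChar p K (a * x) = 1)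
    ⟨kz, fun k hk => by
      by_contra! hlt
      exact hz (hk z (hϖ.lattice_le_lattice hlt.le hkz))⟩ ⟨k, fun x hx => hk hx⟩
  refine ⟨d, hf.continuous, quadChar_add p a b, fun x y => ?_, hd, ?_, ?_⟩
  · rw [mul_add, stdChar_add]
  · by_contra! hall
    have := hmin (d - 1) hall
    lia
  · obtain ⟨m, hm⟩ := hϖ.exists_lattice_subset hf0
    exact ⟨m, fun x hx => hm hx⟩

end StandardCharacter

/-! ### The local zeta function -/

section Zeta

/-- The value of `∑ c k X ^ k` at `X = r ^ s` for coefficients that vanish for `k < l` and equal `M`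
for `k ≥ n`. -/
noncomputable def shellZeta (r : ℝ) (c : ℤ → ℂ) (M : ℂ) (l n : ℤ) (s : ℂ) : ℂ :=
  ∑ k ∈ Finset.Ico l n, c k * ((r : ℂ) ^ s) ^ k + M * ((r : ℂ) ^ s) ^ n / (1 - (r : ℂ) ^ s)

variable {r : ℝ} {c : ℤ → ℂ} {M : ℂ} {l n : ℤ}

theorem ofReal_cpow_ne_zero (hr0 : 0 < r) (s : ℂ) : (r : ℂ) ^ s ≠ 0 := by
  rw [Complex.cpow_def_of_ne_zero (by exact_mod_cast hr0.ne')]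
  exact Complex.exp_ne_zero _

theorem analyticAt_ofReal_cpow (hr0 : 0 < r) (s : ℂ) :
    AnalyticAt ℂ (fun s : ℂ => (r : ℂ) ^ s) s :=
  analyticAt_const.cpow analyticAt_id (by simpa using hr0)

theorem analyticAt_ofReal_cpow_zpow (hr0 : 0 < r) (k : ℤ) (s : ℂ) :
    AnalyticAt ℂ (fun s : ℂ => ((r : ℂ) ^ s) ^ k) s :=
  (analyticAt_ofReal_cpow hr0 s).fun_zpow (ofReal_cpow_ne_zero hr0 s)

theorem analyticAt_shellSum (hr0 : 0 < r) (s : ℂ) :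
    AnalyticAt ℂ (fun s : ℂ => ∑ k ∈ Finset.Ico l n, c k * ((r : ℂ) ^ s) ^ k) s :=
  Finset.analyticAt_fun_sum _ fun k _ => analyticAt_const.mul (analyticAt_ofReal_cpow_zpow hr0 k s)

theorem ofReal_cpow_ne_one (hr0 : 0 < r) (hr1 : r < 1) {s : ℂ} (hs : 0 < s.re) :
    (r : ℂ) ^ s ≠ 1 := by
  intro h
  have h1 := congrArg norm h
  rw [Complex.norm_cpow_eq_rpow_re_of_pos hr0, norm_one] at h1
  exact (Real.rpow_lt_one hr0.le hr1 hs).ne h1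

theorem analyticAt_shellZeta (hr0 : 0 < r) (hr1 : r < 1) {s : ℂ} (hs : 0 < s.re) :
    AnalyticAt ℂ (shellZeta r c M l n) s :=
  (analyticAt_shellSum hr0 s).add ((analyticAt_const.mul (analyticAt_ofReal_cpow_zpow hr0 n s)).div
    (analyticAt_const.sub (analyticAt_ofReal_cpow hr0 s))
    (sub_ne_zero.2 (ofReal_cpow_ne_one hr0 hr1 hs).symm))

theorem meromorphic_shellZeta (hr0 : 0 < r) : Meromorphic (shellZeta r c M l n) := fun s =>
  (analyticAt_shellSum hr0 s).meromorphicAt.add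
    ((analyticAt_const.mul (analyticAt_ofReal_cpow_zpow hr0 n s)).meromorphicAt.div
      (analyticAt_const.sub (analyticAt_ofReal_cpow hr0 s)).meromorphicAt)

/-- At a zero of the zeta function the numerator `(1 - X) ∑ c k X ^ k + M X ^ n` vanishes, also
where `X = 1`. -/
theorem numerator_eq_zero (hr0 : 0 < r) (hr1 : r < 1) {s : ℂ}
    (hs : 0 < meromorphicOrderAt (shellZeta r c M l n) s) :
    (1 - (r : ℂ) ^ s) * ∑ k ∈ Finset.Ico l n, c k * ((r : ℂ) ^ s) ^ k + M * ((r : ℂ) ^ s) ^ n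
      = 0 := by
  have h1 := tendsto_zero_of_meromorphicOrderAt_pos hs
  have hX := analyticAt_ofReal_cpow hr0 s
  have hne : ∀ᶠ z in 𝓝[≠] s, (r : ℂ) ^ z ≠ 1 := by
    have hr : (r : ℂ) ≠ 0 := by exact_mod_cast hr0.ne'
    have hd : HasDerivAt (fun z : ℂ => (r : ℂ) ^ z) ((r : ℂ) ^ s * Complex.log r) s := by
      simpa using (hasDerivAt_id s).const_cpow (Or.inl hr)
    refine hd.eventually_ne (mul_ne_zero (ofReal_cpow_ne_zero hr0 s) ?_)
    rw [← Complex.ofReal_log hr0.le]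
    exact_mod_cast (Real.log_neg hr0 hr1).ne
  have h2 : Tendsto (fun z : ℂ => (1 - (r : ℂ) ^ z) * shellZeta r c M l n z) (𝓝[≠] s) (𝓝 0) := by
    have h3 := ((continuousAt_const (y := (1 : ℂ))).sub hX.continuousAt).tendsto.mono_left
      (nhdsWithin_le_nhds (s := {s}ᶜ))
    simpa using h3.mul h1
  have h4 : ContinuousAt (fun z : ℂ => (1 - (r : ℂ) ^ z) *
      ∑ k ∈ Finset.Ico l n, c k * ((r : ℂ) ^ z) ^ k + M * ((r : ℂ) ^ z) ^ n) s :=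
    (((analyticAt_const.sub hX).mul (analyticAt_shellSum hr0 s)).add
      (analyticAt_const.mul (analyticAt_ofReal_cpow_zpow hr0 n s))).continuousAt
  refine tendsto_nhds_unique (h4.tendsto.mono_left (nhdsWithin_le_nhds (s := {s}ᶜ)))
    (h2.congr' ?_)
  filter_upwards [hne] with z hz
  have : 1 - (r : ℂ) ^ z ≠ 0 := sub_ne_zero.2 hz.symm
  rw [shellZeta]
  field_simp

/-- Two functions that are meromorphic on the plane and agree on a half-plane have the same order
everywhere. -/
theorem meromorphicOrderAt_eq_of_eqOn_re_pos {ζ ξ : ℂ → ℂ} (hζ : Meromorphic ζ)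
    (hξ : Meromorphic ξ) (h : ∀ s : ℂ, 0 < s.re → ζ s = ξ s) (s : ℂ) :
    meromorphicOrderAt ζ s = meromorphicOrderAt ξ s := by
  have hd : Meromorphic (ζ - ξ) := fun z => (hζ z).sub (hξ z)
  have h1 : meromorphicOrderAt (ζ - ξ) 1 = ⊤ := by
    rw [meromorphicOrderAt_eq_top_iff]
    have h2 : ∀ᶠ z : ℂ in 𝓝 1, 0 < z.re :=
      Complex.continuous_re.continuousAt.eventually (lt_mem_nhds (by simp))
    filter_upwards [h2.filter_mono nhdsWithin_le_nhds] with z hz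
    simp [h z hz]
  have h2 : meromorphicOrderAt (ζ - ξ) s = ⊤ := by
    by_contra hne
    exact hd.exists_meromorphicOrderAt_ne_top_iff_forall.1 ⟨s, hne⟩ 1 h1
  rw [meromorphicOrderAt_eq_top_iff] at h2
  refine meromorphicOrderAt_congr ?_
  filter_upwards [h2] with z hz
  exact sub_eq_zero.1 hz

end Zeta

section Uniqueness

variable (p : ℕ) [Fact p.Prime] {K : Type*} [NormedField K] [NormedAlgebra ℚ_[p] K]
  [IsUltrametricDist K] [ProperSpace K] [MeasurableSpace K] [BorelSpace K]

/-- The Mellin transform of the indicator function of the unit sphere is not zero, so a weak Mellin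
transform is unique. -/
theorem IsWeakMellinTransformAt.unique {ϖ : K} (hϖ : IsUniformizer ϖ) (μ : Measure Kˣ)
    [μ.IsHaarMeasure] {f : Kˣ → ℂ} {s M₁ M₂ : ℂ} (h₁ : IsWeakMellinTransformAt p μ f s M₁)
    (h₂ : IsWeakMellinTransformAt p μ f s M₂) : M₁ = M₂ := by
  let A : Set Kˣ := Units.val ⁻¹' shell ϖ 0
  have hAc : IsCompact A := isCompact_preimage_shell hϖ 0
  have hAo : IsOpen A := by
    refine IsOpen.preimage Units.continuous_val ?_
    rw [hϖ.shell_eq_diff]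
    exact (hϖ.isOpen_lattice _).sdiff (isClosed_lattice _)
  let φ : Kˣ → ℂ := A.indicator 1
  have hφ1 : ∀ x ∈ A, φ x = 1 := fun x hx => Set.indicator_of_mem hx 1
  have hφ0 : ∀ x ∉ A, φ x = 0 := fun x hx => Set.indicator_of_notMem hx 1
  have hφ : IsLocallyConstant φ := by
    refine (IsLocallyConstant.iff_eventually_eq _).2 fun x => ?_
    by_cases hx : x ∈ A
    · filter_upwards [hAo.mem_nhds hx] with y hy
      rw [hφ1 x hx, hφ1 y hy]
    · filter_upwards [hAc.isClosed.isOpen_compl.mem_nhds hx] with y hy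
      rw [hφ0 x hx, hφ0 y hy]
  have hc : HasCompactSupport φ :=
    HasCompactSupport.intro hAc fun {x} hx => hφ0 x hx
  have hM : mellinTransform p μ φ s = μ.real A := by
    have h1 : mellinIntegrand p φ s = A.indicator fun _ => 1 := by
      ext x
      by_cases hx : x ∈ A
      · rw [mellinIntegrand, hφ1 x hx, Set.indicator_of_mem hx,
          normAbs_cpow_of_mem_shell p hϖ hx, zpow_zero, mul_one]
      · rw [mellinIntegrand, hφ0 x hx, Set.indicator_of_notMem hx, zero_mul]
    rw [mellinTransform, h1, integral_indicator hAo.measurableSet]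
    simp
  have hne : mellinTransform p μ φ s ≠ 0 := by
    rw [hM]
    have := hAo.measure_pos μ ⟨1, by change ‖((1 : Kˣ) : K)‖ = _; simp⟩
    exact_mod_cast (ENNReal.toReal_pos this.ne' hAc.measure_ne_top).ne'
  exact mul_right_cancel₀ hne ((h₁ φ hφ hc).2.2.symm.trans (h₂ φ hφ hc).2.2)

end Uniqueness

/-- The local zeta function of a non-degenerate `ψ(½ a x² + b x)` is explicitly `shellZeta`, with a
numerator that vanishes only on the critical line. -/
theorem exists_isLocalZeta_shellZeta (p : ℕ) [Fact p.Prime] {K : Type*} [NormedField K]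
    [NormedAlgebra ℚ_[p] K] [FiniteDimensional ℚ_[p] K] [IsUltrametricDist K] [ProperSpace K]
    [MeasurableSpace K] [BorelSpace K] (μ : Measure Kˣ) [μ.IsHaarMeasure] {ϖ : K}
    (hϖ : IsUniformizer ϖ) {a b : K}
    (hf : IsNondegenerateSecondDegreeCharacter (quadChar p K a b)) :
    ∃ (r : ℝ) (c : ℤ → ℂ) (M : ℂ) (l n : ℤ), 0 < r ∧ r < 1 ∧
      IsLocalZeta p μ (fun x : Kˣ => (quadChar p K a b (x : K) : ℂ)) (shellZeta r c M l n) ∧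
      ∀ X : ℂ, X ≠ 0 → (1 - X) * ∑ k ∈ Finset.Ico l n, c k * X ^ k + M * X ^ n = 0 →
        ‖X‖ ^ 2 = r := by
  obtain ⟨d, h⟩ := exists_isQuadratic_quadChar p hϖ hf
  set f := quadChar p K a b
  let ν : Measure K := Measure.addHaar
  have hmod := distribHaarChar_eq p (K := K)
  set N := Module.finrank ℚ_[p] K with hN
  have hNpos : N ≠ 0 := (Module.finrank_pos (R := ℚ_[p]) (M := K)).ne'
  obtain ⟨C, hC0, hC⟩ := exists_setIntegral_units_eq ν μ hmod hϖ
  have hr0 : 0 < normAbs p K ϖ := pow_pos hϖ.norm_pos _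
  have hr1 : normAbs p K ϖ < 1 := pow_lt_one₀ (norm_nonneg _) hϖ.norm_lt_one hNpos
  set r := normAbs p K ϖ with hr
  set v := ν.real (lattice ϖ 0 : Set K)
  have hv : 0 < v := ENNReal.toReal_pos
    ((hϖ.isOpen_lattice 0).measure_pos ν ⟨0, zero_mem _⟩).ne'
    (IsQuadratic.measure_lattice_ne_top ν 0)
  have hν : ∀ k, ν.real (lattice ϖ k : Set K) = r ^ k * v := by
    intro k
    let w : Kˣ := Units.mk0 ϖ hϖ.ne_zero ^ k
    have hw : (w : K) = ϖ ^ k := by simp [w]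
    have h1 : (lattice ϖ k : Set K) = w • (lattice ϖ 0 : Set K) := by
      ext x
      rw [Set.mem_smul_set_iff_inv_smul_mem, SetLike.mem_coe, SetLike.mem_coe, mem_lattice,
        mem_lattice, Units.smul_def, smul_eq_mul, norm_mul, Units.val_inv_eq_inv_val, norm_inv, hw,
        norm_zpow, zpow_zero, inv_mul_le_one₀ (zpow_pos hϖ.norm_pos k)]
    rw [h1, Measure.real, ← distribHaarChar_mul ν, ENNReal.toReal_mul, hmod, hw]
    congr 1
    rw [ENNReal.coe_toReal, NNReal.coe_pow, coe_nnnorm, norm_zpow, hr,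
      normAbs, ← zpow_natCast, ← zpow_natCast, zpow_comm]
  obtain ⟨l, n, hln, hl, hn, hP⟩ := h.exists_shell_integrals ν hϖ hr0 hr1 hv hν
  have hshell : ∀ k, MeasurableSet (shell ϖ k) := fun k => by
    rw [hϖ.shell_eq_diff]
    exact (IsQuadratic.measurableSet_lattice _).diff (IsQuadratic.measurableSet_lattice _)
  set c : ℤ → ℂ := fun k => C * ((r : ℂ) ^ (-k) * ∫ x in shell ϖ k, (f x : ℂ) ∂ν) with hcdef
  have hc : ∀ k, ∫ x in Units.val ⁻¹' shell ϖ k, (f ((x : Kˣ) : K) : ℂ) ∂μ = c k := fun k =>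
    hC k _ (hshell k) subset_rfl fun x => (f x : ℂ)
  have hcl : ∀ k < l, c k = 0 := fun k hk => by simp only [hcdef, hl k hk, mul_zero]
  have hcn : ∀ k, n ≤ k → c k = C * (v * (1 - r)) := fun k hk => by
    simp only [hcdef, hn k hk]
  have hV : ∀ k, μ.real (Units.val ⁻¹' shell ϖ k) = C * (v * (1 - r)) := by
    intro k
    have h1 := hC k _ (hshell k) subset_rfl fun _ => 1
    have h2 : ν.real (shell ϖ k) = r ^ k * v - r ^ (k + 1) * v := by
      rw [hϖ.shell_eq_diff, measureReal_sdiff (hϖ.lattice_le_lattice (by lia))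
        (IsQuadratic.measurableSet_lattice _) (IsQuadratic.measure_lattice_ne_top ν _), hν, hν]
    have h3 : μ.real (Units.val ⁻¹' shell ϖ k) =
        C * (r ^ (-k) * ν.real (shell ϖ k)) := by
      simp only [setIntegral_const, Complex.real_smul, mul_one] at h1
      exact_mod_cast h1
    rw [h3, h2, zpow_add_one₀ hr0.ne', zpow_neg]
    have : r ^ k ≠ 0 := (zpow_pos hr0 k).ne'
    field_simp
  refine ⟨r, c, C * (v * (1 - r)), l, n, hr0, hr1, ⟨fun s hs φ hφ hφc => ?_,
    fun s hs => analyticAt_shellZeta hr0 hr1 hs, meromorphic_shellZeta hr0⟩, fun X hX hX0 => ?_⟩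
  · obtain ⟨l₀, hl₀⟩ := h.exists_mulConv_eq hϖ μ hmod hφ hφc
    obtain ⟨h1, h2⟩ := mellin_indicator_lattice p h.continuous hϖ μ (min_le_right l₀ l) hln hV hc
      hcl hcn hr1 hs
    have hφi : Integrable (mellinIntegrand p φ s) μ :=
      (continuous_mellinIntegrand p hφ.continuous s).integrable_of_hasCompactSupport hφc.mul_right
    obtain ⟨h3, h4⟩ := integrable_mellinIntegrand_mulConv p μ hφi h1
    rw [← hl₀ _ (min_le_left l₀ l)] at h3 h4
    refine ⟨fun y => ?_, h3, by rw [h4, h2, shellZeta]⟩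
    have hF : Continuous fun x : Kˣ => (f ((x⁻¹ * y : Kˣ) : K) : ℂ) :=
      continuous_subtype_val.comp (h.continuous.comp (Units.continuous_val.comp (by fun_prop)))
    exact (hφ.continuous.mul hF).integrable_of_hasCompactSupport hφc.mul_right
  · refine hP X hX ?_
    have hC' : (C : ℂ) ≠ 0 := by exact_mod_cast hC0.ne'
    refine (mul_eq_zero.1 ?_).resolve_left hC'
    rw [← hX0, mul_add, mul_left_comm, Finset.mul_sum]
    simp only [hcdef, mul_assoc]

end WeakMellin

theorem mainTheorem2 (p : ℕ) [Fact p.Prime] (K : Type*) [NormedField K] [NormedAlgebra ℚ_[p] K]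
    [FiniteDimensional ℚ_[p] K] [MeasurableSpace K] [BorelSpace K]
    (μ : Measure Kˣ) [μ.IsHaarMeasure] (a b : K)
    (hf : WeakMellin.IsNondegenerateSecondDegreeCharacter (WeakMellin.quadChar p K a b)) :
    (∃ ζ : ℂ → ℂ, WeakMellin.IsLocalZeta p μ
      (fun x : Kˣ => (WeakMellin.quadChar p K a b (x : K) : ℂ)) ζ) ∧
    ∀ ζ : ℂ → ℂ, WeakMellin.IsLocalZeta p μ
      (fun x : Kˣ => (WeakMellin.quadChar p K a b (x : K) : ℂ)) ζ →
      ∀ s : ℂ, 0 < meromorphicOrderAt ζ s → s.re = 1 / 2 := by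
  have := WeakMellin.isUltrametricDist_of_padic p K
  have : ProperSpace K := FiniteDimensional.proper ℚ_[p] K
  have hp : p.Prime := Fact.out
  have hnorm := WeakMellin.norm_natCast_prime p K
  obtain ⟨ϖ, hϖ⟩ := WeakMellin.exists_isUniformizer (K := K) ⟨(p : K), by
    rw [← norm_pos_iff, hnorm, inv_pos]
    exact_mod_cast hp.pos, by
    rw [hnorm]
    exact inv_lt_one_of_one_lt₀ (by exact_mod_cast hp.one_lt)⟩
  obtain ⟨r, c, M, l, n, hr0, hr1, hζ₀, hzero⟩ :=
    WeakMellin.exists_isLocalZeta_shellZeta p μ hϖ hf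
  refine ⟨⟨_, hζ₀⟩, fun ζ hζ s hs => ?_⟩
  rw [WeakMellin.meromorphicOrderAt_eq_of_eqOn_re_pos hζ.meromorphic hζ₀.meromorphic
    fun z hz => (hζ.isWeakMellin z hz).unique p hϖ μ (hζ₀.isWeakMellin z hz)] at hs
  have h1 := hzero _ (WeakMellin.ofReal_cpow_ne_zero hr0 s)
    (WeakMellin.numerator_eq_zero hr0 hr1 hs)
  rw [Complex.norm_cpow_eq_rpow_re_of_pos hr0, ← Real.rpow_mul_natCast hr0.le] at h1
  have h2 : s.re * (2 : ℕ) = 1 := by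
    refine (Real.rpow_right_inj hr0 hr1.ne).1 ?_
    rw [h1, Real.rpow_one]
  push_cast at h2
  linarith
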